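/- Let $d\ge 0$ be an integer, and let $G$ be $U(d)$ [resp. $SU(d)$]. Let $T_{U(d)}=\{\operatorname{diag}(e^{i\theta_1},\dots,e^{i\theta_d}):\theta_j\in\mathbb R\}$ and $T_{SU(d)}=\{\operatorname{diag}(e^{i\theta_1},\dots,e^{i\theta_d}):\theta_j\in\mathbb R,\ \theta_1+\dots+\theta_d\equiv 0 \ (\mathrm{mod}\ 2\pi)\}$ be the standard maximal tori. For a closed subgroup $K\subseteq U(d)$ write $\operatorname{Lie}(K)=\{X\in M_d(\mathbb C): \exp(tX)\in K \text{ for all } t\in\mathbb R\}$. **Theorem (Block-diagonal structure).** Let $H\subseteq G$ be a connected closed subgroup that contains $T_G$. Then there exist positive integers $d_1,\dots,d_r$ with $d=d_1+\dots+d_r$ and a $d\times d$ permutation matrix $P$ such that the conjugated subgroup $\tilde H=PHP^{-1}$ is exactly the block-diagonal subgroup $$\tilde H=\prod_{j=1}^r U(d_j)=\{\operatorname{diag}(A_1,\dots,A_r): A_j\in U(d_j)\}\quad\Bigl[\text{resp. } \tilde H=S\Bigl(\prod_{j=1}^r U(d_j)\Bigr)=\Bigl(\prod_{j=1}^r U(d_j)\Bigr)\cap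 SU(d)\Bigr].$$ Furthermore $\operatorname{Lie}(\tilde H)=P\operatorname{Lie}(H)P^{-1}$, and, for the same $d_j$ and $P$, $$\operatorname{Lie}(\tilde H)=\bigoplus_{j=1}^r\mathfrak u(d_j)\quad\Bigl[\text{resp. } \operatorname{Lie}(\tilde H)=\bigoplus_{j=1}^r\mathfrak{su}(d_j)\oplus i\mathbb R^{r-1}\Bigr]$$ as real Lie algebras of matrices. Here the sums of $\mathfrak u(d_j)$ and $\mathfrak{su}(d_j)$ are embedded as block-diagonal matrices, and $i\mathbb R^{r-1}$ is an abelian Lie algebra of real dimension $r-1$ (of dimension $0$ if $d=0$) embedded as block-scalar matrices $\operatorname{diag}(ia_1I_{d_1},\dots,ia_rI_{d_r})$ with $a_j\in\mathbb R$. In particular, if $H\neq G$, then there is a set $S$ with $\emptyset\ne S\subsetneq\{1,\dots,d\}$ such that every element of $H$ maps the coordinate subspace $\operatorname{span}\{e_j: j\in S\}\subseteq\mathbb C^d$ into itself. -/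

import Mathlib

open scoped Matrix DirectSum

/-! Associative rings carry the commutator bracket `⁅X, Y⁆ = X * Y - Y * X`. -/

attribute [local instance 100] LieRing.ofAssociativeRing

noncomputable section

namespace BlockUnitary

/-- The unitary group `U(n)`. -/
abbrev U (n : ℕ) : Type := Matrix.unitaryGroup (Fin n) ℂ

/-- The special unitary group `SU(n)`, as a subgroup of `U(n)`. -/
def SU (n : ℕ) : Subgroup (U n) :=
  (Matrix.detMonoidHom.comp (Matrix.unitaryGroup (Fin n) ℂ).subtype).ker

theorem mem_SU_iff {n : ℕ} (A : U n) :
    A ∈ SU n ↔ (A : Matrix (Fin n) (Fin n) ℂ) ∈ Matrix.specialUnitaryGroup (Fin n) ℂ := by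
  rw [Matrix.mem_specialUnitaryGroup_iff]
  exact ⟨fun h => ⟨A.2, h⟩, fun h => h.2⟩

/-- The diagonal unitary matrix `diag(e^{iθ_1}, …, e^{iθ_n})`. -/
def diagPhase {n : ℕ} (θ : Fin n → ℝ) : U n :=
  ⟨Matrix.diagonal fun j => Complex.exp (θ j * Complex.I), by
    rw [Matrix.mem_unitaryGroup_iff, Matrix.star_eq_conjTranspose, Matrix.diagonal_conjTranspose,
      Matrix.diagonal_mul_diagonal, ← Matrix.diagonal_one]
    congr 1
    funext j
    simp [← Complex.exp_conj, ← Complex.exp_add]⟩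

/-- The standard maximal torus of `U(n)`: all `diag(e^{iθ_1}, …, e^{iθ_n})`. -/
def torusU (n : ℕ) : Set (U n) := Set.range diagPhase

/-- The standard maximal torus of `SU(n)`: all `diag(e^{iθ_1}, …, e^{iθ_n})` with
`θ_1 + ⋯ + θ_n ≡ 0 (mod 2π)`. -/
def torusSU (n : ℕ) : Set (U n) :=
  diagPhase '' {θ : Fin n → ℝ | ∃ k : ℤ, ∑ j, θ j = k * (2 * Real.pi)}

/-- The permutation matrix of `σ`, as an element of `U(n)`. -/
def permU {n : ℕ} (σ : Equiv.Perm (Fin n)) : U n :=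
  ⟨σ.permMatrix ℂ, by
    rw [Matrix.mem_unitaryGroup_iff, Matrix.star_eq_conjTranspose,
      Matrix.conjTranspose_permMatrix, ← Matrix.permMatrix_mul]
    simp⟩

/-- The conjugate subgroup `P H P⁻¹`. -/
def conjSubgroup {n : ℕ} (P : U n) (H : Subgroup (U n)) : Subgroup (U n) :=
  H.map (MulAut.conj P).toMonoidHom

/-- The Lie algebra of a closed subgroup `H` of `U(n)`, realised as a set of matrices:
all `X` such that `exp(tX) ∈ H` for every real `t`. -/
def lieOf {n : ℕ} (H : Subgroup (U n)) : Set (Matrix (Fin n) (Fin n) ℂ) :=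
  {X | ∀ t : ℝ, ∃ A ∈ H, (A : Matrix (Fin n) (Fin n) ℂ) = NormedSpace.exp (t • X)}

/-- The conjugate `P L P⁻¹` of a set of matrices. -/
def conjSet {n : ℕ} (P : U n) (L : Set (Matrix (Fin n) (Fin n) ℂ)) :
    Set (Matrix (Fin n) (Fin n) ℂ) :=
  (fun X => (P : Matrix (Fin n) (Fin n) ℂ) * X * (P⁻¹ : U n)) '' L

/-- The real Lie algebra `𝔲(n)` of skew-Hermitian matrices. -/
def u (n : ℕ) : LieSubalgebra ℝ (Matrix (Fin n) (Fin n) ℂ) where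
  carrier := {X | Xᴴ = -X}
  zero_mem' := by simp
  add_mem' := by
    intro X Y hX hY
    simp only [Set.mem_ofPred_eq] at *
    rw [Matrix.conjTranspose_add, hX, hY]
    abel
  smul_mem' := by
    intro c X hX
    simp only [Set.mem_ofPred_eq] at *
    rw [Matrix.conjTranspose_smul, hX]
    simp
  lie_mem' := by
    intro X Y hX hY
    simp only [Set.mem_ofPred_eq] at *
    rw [Ring.lie_def, Matrix.conjTranspose_sub, Matrix.conjTranspose_mul,
      Matrix.conjTranspose_mul, hX, hY]
    noncomm_ring

/-- The real Lie algebra `𝔰𝔲(n)` of traceless skew-Hermitian matrices. -/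
def su (n : ℕ) : LieSubalgebra ℝ (Matrix (Fin n) (Fin n) ℂ) where
  carrier := {X | X ∈ u n ∧ X.trace = 0}
  zero_mem' := ⟨(u n).zero_mem, by simp⟩
  add_mem' := fun hX hY =>
    ⟨(u n).add_mem hX.1 hY.1, by rw [Matrix.trace_add, hX.2, hY.2, add_zero]⟩
  smul_mem' := fun c _ hX =>
    ⟨(u n).smul_mem c hX.1, by rw [Matrix.trace_smul, hX.2, smul_zero]⟩
  lie_mem' := fun {X Y} hX hY =>
    ⟨(u n).lie_mem hX.1 hY.1, by
      rw [Ring.lie_def, Matrix.trace_sub, Matrix.trace_mul_comm, sub_self]⟩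

/-! A decomposition `d = d_1 + ⋯ + d_r` into positive parts is a `c : Composition d`, with
`r = c.length` and `d_j = c.blocksFun j`. The blocks occupy consecutive indices of `Fin d`. -/

/-- The block-diagonal `d × d` matrix `diag(A_1, …, A_r)`. -/
def blockDiag {d : ℕ} (c : Composition d)
    (A : ∀ j : Fin c.length, Matrix (Fin (c.blocksFun j)) (Fin (c.blocksFun j)) ℂ) :
    Matrix (Fin d) (Fin d) ℂ :=
  Matrix.reindex c.blocksFinEquiv c.blocksFinEquiv (Matrix.blockDiagonal' A)

theorem blockDiag_mul {d : ℕ} (c : Composition d)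
    (A B : ∀ j : Fin c.length, Matrix (Fin (c.blocksFun j)) (Fin (c.blocksFun j)) ℂ) :
    blockDiag c (fun j => A j * B j) = blockDiag c A * blockDiag c B := by
  simp [blockDiag, Matrix.blockDiagonal'_mul, Matrix.submatrix_mul_equiv]

theorem blockDiag_one {d : ℕ} (c : Composition d) : blockDiag c (fun _ => 1) = 1 := by
  have h := Matrix.blockDiagonal'_one (α := ℂ) (m' := fun j => Fin (c.blocksFun j))
  have h' : Matrix.blockDiagonal'
      (fun j => (1 : Matrix (Fin (c.blocksFun j)) (Fin (c.blocksFun j)) ℂ)) = 1 := h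
  simp [blockDiag, h']

theorem blockDiag_conjTranspose {d : ℕ} (c : Composition d)
    (A : ∀ j : Fin c.length, Matrix (Fin (c.blocksFun j)) (Fin (c.blocksFun j)) ℂ) :
    (blockDiag c A)ᴴ = blockDiag c (fun j => (A j)ᴴ) := by
  simp [blockDiag, Matrix.conjTranspose_submatrix, Matrix.blockDiagonal'_conjTranspose]

/-- The block embedding `U(d_1) × ⋯ × U(d_r) → U(d)`. -/
def blockHom {d : ℕ} (c : Composition d) : (∀ j : Fin c.length, U (c.blocksFun j)) →* U d where
  toFun A := ⟨blockDiag c fun j => A j, by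
    rw [Matrix.mem_unitaryGroup_iff, Matrix.star_eq_conjTranspose, blockDiag_conjTranspose,
      ← blockDiag_mul, ← blockDiag_one c]
    congr 1
    funext j
    exact Matrix.mem_unitaryGroup_iff.1 (A j).2⟩
  map_one' := Subtype.ext (blockDiag_one c)
  map_mul' A B := Subtype.ext (blockDiag_mul c _ _)

/-- The block-diagonal subgroup `∏ U(d_j)` of `U(d)`. -/
def blockU {d : ℕ} (c : Composition d) : Subgroup (U d) := (blockHom c).range

/-- The block-diagonal subgroup `S(∏ U(d_j)) = (∏ U(d_j)) ∩ SU(d)`. -/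
def blockSU {d : ℕ} (c : Composition d) : Subgroup (U d) := blockU c ⊓ SU d

/-- The block embedding `𝔤_1 ⊕ ⋯ ⊕ 𝔤_r → M_d(ℂ)`, for real Lie algebras `𝔤_j` of
`d_j × d_j` matrices. -/
def blockLieHom {d : ℕ} (c : Composition d)
    (g : ∀ j : Fin c.length,
      LieSubalgebra ℝ (Matrix (Fin (c.blocksFun j)) (Fin (c.blocksFun j)) ℂ)) :
    (⨁ j : Fin c.length, g j) →ₗ⁅ℝ⁆ Matrix (Fin d) (Fin d) ℂ where
  toFun X := blockDiag c fun j => X j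
  map_add' X Y := by
    ext a b
    exact congrFun (congrFun (Matrix.blockDiagonal'_add
      (fun j => (X j).1) (fun j => (Y j).1)) _) _
  map_smul' t X := by
    ext a b
    exact congrFun (congrFun (Matrix.blockDiagonal'_smul t (fun j => (X j).1)) _) _
  map_lie' := by
    intro X Y
    rw [Ring.lie_def, ← blockDiag_mul, ← blockDiag_mul]
    simp only [DirectSum.bracket_apply, LieSubalgebra.coe_bracket, Ring.lie_def]
    ext a b
    exact congrFun (congrFun (Matrix.blockDiagonal'_sub
      (fun j => (X j).1 * (Y j).1) (fun j => (Y j).1 * (X j).1)) _) _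

/-- The block-scalar matrices `diag(i a_1 I_{d_1}, …, i a_r I_{d_r})` with real `a_j`. -/
def blockScalars {d : ℕ} (c : Composition d) : Set (Matrix (Fin d) (Fin d) ℂ) :=
  Set.range fun a : Fin c.length → ℝ => blockDiag c fun j => (Complex.I * (a j : ℂ)) • 1

/-- The coordinate subspace of `ℂ^d` spanned by the `e_j` with `j ∈ S`. -/
def coordSubspace {d : ℕ} (S : Set (Fin d)) : Submodule ℂ (Fin d → ℂ) :=
  Submodule.span ℂ ((fun j => Pi.single j (1 : ℂ)) '' S)

/-- `H` maps some coordinate subspace, other than `0` and `ℂ^d`, into itself. -/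
def PreservesCoordSubspace {d : ℕ} (H : Subgroup (U d)) : Prop :=
  ∃ S : Set (Fin d), S.Nonempty ∧ S ≠ Set.univ ∧
    ∀ A ∈ H, ∀ v ∈ coordSubspace S, (A : Matrix (Fin d) (Fin d) ℂ) *ᵥ v ∈ coordSubspace S

end BlockUnitary

end

open BlockUnitary

/-! Case `U(d)`. For closed H, Lie(H) is a real subspace, stable under conjugation by H and under
brackets. Conjugating by the torus splits it into root spaces: if some X in Lie(H) has X i j ≠ 0,
then the whole root space of (i, j) lies in Lie(H) (`linked_of_ne_zero`). Brackets make this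
relation on coordinates transitive, so Lie(H) consists exactly of the skew-Hermitian matrices that
are block-diagonal for its classes. Let B be the group of unitary matrices with this block pattern.
Each element of B is an exponential of a block-diagonal skew-Hermitian matrix, so B ≤ H
(`relBlock_le`).

Conversely, H agrees with B near 1 (`eventually_mem_relBlock`). Otherwise elements of H outside B
tend to 1; replace each by a point of its B-coset closest to 1. A limit direction X of these points
lies in Lie(H), hence is block-diagonal, while minimality makes it orthogonal to every
block-diagonal direction, itself included; so X = 0, a contradiction. Thus B is open in H, and
connectedness gives H = B. Listing the coordinates class by class gives the composition and the
permutation.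

Case `SU(d)`. The group generated by H and the unit scalars is closed, connected and contains the
full torus, so the first case applies. Intersecting it with `SU(d)` returns H, because scalars of
determinant 1 already lie in the torus of `SU(d)`. On Lie algebras, det exp = exp tr gives the trace
condition, and removing the trace of each block splits off the block scalars. -/

noncomputable section

open Matrix Filter Topology

namespace BlockUnitary

/-! ### Powers of elements near the identity and the exponential. -/

section Exponential

open NormedSpace

/-- In a Banach algebra, `(1 + Z)^m → exp W` as soon as `Z → 0` and `m Z → W`. -/
theorem tendsto_one_add_pow_exp {ι 𝔸 : Type*} [NormedRing 𝔸] [NormedAlgebra ℝ 𝔸]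
    [CompleteSpace 𝔸] {l : Filter ι} {m : ι → ℕ} {Z : ι → 𝔸} {W : 𝔸}
    (hZ : Tendsto Z l (𝓝 0)) (h : Tendsto (fun n => (m n : ℝ) • Z n) l (𝓝 W)) :
    Tendsto (fun n => (1 + Z n) ^ m n) l (𝓝 (exp W)) := by
  let +nondep : NormedAlgebra ℚ 𝔸 := .restrictScalars ℚ ℝ 𝔸
  have hs : HasStrictFDerivAt (exp : 𝔸 → 𝔸)
      ((ContinuousLinearEquiv.refl ℝ 𝔸 : 𝔸 ≃L[ℝ] 𝔸) : 𝔸 →L[ℝ] 𝔸) 0 :=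
    hasStrictFDerivAt_exp_zero (𝕂 := ℝ)
  -- ℓ is a local logarithm at 1 with derivative the identity there, so m ℓ(1 + Z) and m Z have the
  -- same limit, while (1 + Z)^m = exp(m ℓ(1 + Z)).
  obtain ⟨ℓ, hℓ⟩ : ∃ ℓ, ℓ = hs.localInverse := ⟨_, rfl⟩
  have h1 := hs.eventually_right_inverse
  have h2 := hs.to_localInverse.hasFDerivAt
  have h0 := hs.localInverse_apply_image
  rw [exp_zero] at h1 h2 h0
  rw [hasFDerivAt_iff_isLittleO_nhds_zero] at h2
  rw [← hℓ] at h0 h1 h2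
  rw [h0] at h2
  have h3 : Tendsto (fun n => 1 + Z n) l (𝓝 1) := by simpa using hZ.const_add 1
  have h4 : (fun n => (m n : ℝ) • ℓ (1 + Z n) - (m n : ℝ) • Z n) =o[l]
      (fun n => (m n : ℝ) • Z n) := by
    have := (Asymptotics.isBigO_refl (fun n => (m n : ℝ)) l).smul_isLittleO
      (h2.comp_tendsto hZ)
    simpa [Function.comp_def, smul_sub] using this
  have h5 : Tendsto (fun n => (m n : ℝ) • ℓ (1 + Z n)) l (𝓝 W) := by
    have h6 := (Asymptotics.isLittleO_one_iff ℝ).1 (h4.trans_isBigO (h.isBigO_one ℝ))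
    simpa using h6.add h
  refine ((exp_continuous (𝔸 := 𝔸)).continuousAt.tendsto.comp h5).congr' ?_
  filter_upwards [h3.eventually h1] with n hn
  rw [Function.comp_apply, Nat.cast_smul_eq_nsmul, NormedSpace.exp_nsmul, hn]

end Exponential

section Norm

open scoped Matrix.Norms.L2Operator

variable {d : ℕ}

theorem isCompact_coe_unitary :
    IsCompact (unitaryGroup (Fin d) ℂ : Set (Matrix (Fin d) (Fin d) ℂ)) := by
  have : ProperSpace (Matrix (Fin d) (Fin d) ℂ) := FiniteDimensional.proper ℂ _
  refine Metric.isCompact_of_isClosed_isBounded ?_ ?_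
  · exact isClosed_unitary
  · rw [isBounded_iff_forall_norm_le]
    refine ⟨1, fun A hA => ?_⟩
    rcases subsingleton_or_nontrivial (Matrix (Fin d) (Fin d) ℂ) with h | h
    · simp [Subsingleton.elim A 0]
    · exact (CStarRing.norm_of_mem_unitary hA).le

theorem exp_mem_unitaryGroup {X : Matrix (Fin d) (Fin d) ℂ} (hX : X ∈ u d) :
    NormedSpace.exp X ∈ unitaryGroup (Fin d) ℂ := by
  let +nondep : NormedAlgebra ℚ (Matrix (Fin d) (Fin d) ℂ) := .restrictScalars ℚ ℂ _
  exact NormedSpace.exp_mem_unitary_of_mem_skewAdjoint hX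

/-- If g n leaves 1 in direction X with step 1 / a n, then about t · a n steps lead to exp(tX). -/
theorem tendsto_pow_exp {ι : Type*} {l : Filter ι} {g : ι → Matrix (Fin d) (Fin d) ℂ}
    {a : ι → ℝ} (ha : Tendsto a l atTop) {X : Matrix (Fin d) (Fin d) ℂ}
    (h : Tendsto (fun n => a n • (g n - 1)) l (𝓝 X)) {t : ℝ} (ht : 0 ≤ t) :
    Tendsto (fun n => g n ^ ⌊t * a n⌋₊) l (𝓝 (NormedSpace.exp (t • X))) := by
  have hne : ∀ᶠ n in l, a n ≠ 0 := (ha.eventually_gt_atTop 0).mono fun n hn => hn.ne'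
  have hZ : Tendsto (fun n => g n - 1) l (𝓝 0) := by
    have := (tendsto_inv_atTop_zero.comp ha).smul h
    rw [zero_smul] at this
    refine this.congr' (hne.mono fun n hn => ?_)
    simp [smul_smul, hn]
  have hm : Tendsto (fun n => ((⌊t * a n⌋₊ : ℕ) : ℝ) • (g n - 1)) l (𝓝 (t • X)) := by
    refine (((tendsto_nat_floor_mul_div_atTop ht).comp ha).smul h).congr' (hne.mono fun n hn => ?_)
    simp only [Function.comp_apply, smul_smul]
    rw [div_mul_cancel₀ _ hn]
  simpa using tendsto_one_add_pow_exp hZ hm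

theorem hasDerivAt_exp_smul_zero (X : Matrix (Fin d) (Fin d) ℂ) :
    HasDerivAt (fun t : ℝ => NormedSpace.exp (t • X)) X 0 := by
  simpa [NormedSpace.exp_zero] using hasDerivAt_exp_smul_const (𝕂 := ℝ) X 0

theorem tendsto_slope_exp (X : Matrix (Fin d) (Fin d) ℂ) :
    Tendsto (fun n : ℕ => (n : ℝ) • (NormedSpace.exp ((n : ℝ)⁻¹ • X) - 1)) atTop (𝓝 X) := by
  have h := (hasDerivAt_exp_smul_zero X).tendsto_slope_zero
  have h2 : Tendsto (fun n : ℕ => (n : ℝ)⁻¹) atTop (𝓝[≠] 0) := by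
    rw [tendsto_nhdsWithin_iff]
    exact ⟨tendsto_inv_atTop_nhds_zero_nat, (eventually_gt_atTop 0).mono fun n hn => by
      simpa using hn.ne'⟩
  simpa [Function.comp_def, NormedSpace.exp_zero] using h.comp h2

theorem tendsto_exp_inv_smul (X : Matrix (Fin d) (Fin d) ℂ) :
    Tendsto (fun n : ℕ => NormedSpace.exp ((n : ℝ)⁻¹ • X)) atTop (𝓝 1) := by
  have := (hasDerivAt_exp_smul_zero X).continuousAt.tendsto.comp tendsto_inv_atTop_nhds_zero_nat
  simpa [Function.comp_def, NormedSpace.exp_zero] using this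

end Norm

/-! ### The Lie algebra of a closed subgroup. -/

instance compactSpace_U {d : ℕ} : CompactSpace (U d) :=
  isCompact_iff_compactSpace.1 isCompact_coe_unitary

theorem isCompact_coe {d : ℕ} {H : Subgroup (U d)} (hH : IsClosed (H : Set (U d))) :
    IsCompact (Subtype.val '' (H : Set (U d)) : Set (Matrix (Fin d) (Fin d) ℂ)) :=
  hH.isCompact.image continuous_subtype_val

theorem coe_inv_exp {d : ℕ} {A : U d} {X : Matrix (Fin d) (Fin d) ℂ}
    (h : (A : Matrix (Fin d) (Fin d) ℂ) = NormedSpace.exp X) :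
    ((A⁻¹ : U d) : Matrix (Fin d) (Fin d) ℂ) = NormedSpace.exp (-X) := by
  rw [Matrix.exp_neg, ← h]
  refine (Matrix.inv_eq_right_inv ?_).symm
  exact congrArg Subtype.val (mul_inv_cancel A)

variable {d : ℕ}

/-- Powers of g n stay in H and approximate exp(tX) for t ≥ 0; closedness puts the limit in H, and
inversion handles t < 0. This yields both sums in Lie(H) and limit directions of sequences in H. -/
theorem mem_lieOf_of_tendsto {H : Subgroup (U d)} (hH : IsClosed (H : Set (U d)))
    {ι : Type*} {l : Filter ι} [l.NeBot] {g : ι → U d} (hg : ∀ n, g n ∈ H)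
    {a : ι → ℝ} (ha : Tendsto a l atTop) {X : Matrix (Fin d) (Fin d) ℂ}
    (h : Tendsto (fun n => a n • ((g n : Matrix (Fin d) (Fin d) ℂ) - 1)) l (𝓝 X)) :
    X ∈ lieOf H := by
  have key : ∀ t : ℝ, 0 ≤ t →
      ∃ A ∈ H, (A : Matrix (Fin d) (Fin d) ℂ) = NormedSpace.exp (t • X) := by
    intro t ht
    refine (isCompact_coe hH).isClosed.mem_of_tendsto (tendsto_pow_exp ha h ht)
      (Eventually.of_forall fun n => ?_)
    exact ⟨g n ^ ⌊t * a n⌋₊, H.pow_mem (hg n) _, by simp⟩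
  intro t
  rcases le_total 0 t with ht | ht
  · exact key t ht
  · obtain ⟨A, hA, hAX⟩ := key (-t) (by linarith)
    exact ⟨A⁻¹, H.inv_mem hA, by simpa using coe_inv_exp hAX⟩

/-- Unitarity of exp(X/n) says exp(Xᴴ/n) = exp(-X/n); comparing slopes at 0 gives Xᴴ = -X. -/
theorem lieOf_le_u {H : Subgroup (U d)} {X : Matrix (Fin d) (Fin d) ℂ} (hX : X ∈ lieOf H) :
    X ∈ u d := by
  have h1 := tendsto_slope_exp (Xᴴ)
  have h2 := tendsto_slope_exp (-X)
  refine tendsto_nhds_unique h1 (h2.congr fun n => ?_)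
  obtain ⟨A, -, hA⟩ := hX (n : ℝ)⁻¹
  have h3 := coe_inv_exp hA
  have h4 : ((n : ℝ)⁻¹ • Xᴴ) = ((n : ℝ)⁻¹ • X)ᴴ := by simp [conjTranspose_smul]
  rw [h4, Matrix.exp_conjTranspose, ← hA, smul_neg, ← h3]
  rfl

theorem smul_mem_lieOf {H : Subgroup (U d)} {X : Matrix (Fin d) (Fin d) ℂ} (hX : X ∈ lieOf H)
    (s : ℝ) : s • X ∈ lieOf H := fun t => by simpa [smul_smul] using hX (t * s)

theorem exp_conj_coe (P : U d) (X : Matrix (Fin d) (Fin d) ℂ) :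
    NormedSpace.exp ((P : Matrix (Fin d) (Fin d) ℂ) * X * (P⁻¹ : U d)) =
      (P : Matrix (Fin d) (Fin d) ℂ) * NormedSpace.exp X * (P⁻¹ : U d) :=
  Matrix.exp_units_conj (Unitary.toUnits P) X

theorem conj_smul_coe (P : U d) (t : ℝ) (X : Matrix (Fin d) (Fin d) ℂ) :
    t • ((P : Matrix (Fin d) (Fin d) ℂ) * X * (P⁻¹ : U d)) =
      (P : Matrix (Fin d) (Fin d) ℂ) * (t • X) * (P⁻¹ : U d) := by
  simp

theorem conj_mem_lieOf {H : Subgroup (U d)} {X : Matrix (Fin d) (Fin d) ℂ} (hX : X ∈ lieOf H)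
    {P : U d} (hP : P ∈ H) :
    (P : Matrix (Fin d) (Fin d) ℂ) * X * (P⁻¹ : U d) ∈ lieOf H := by
  intro t
  obtain ⟨A, hA, hAX⟩ := hX t
  refine ⟨P * A * P⁻¹, H.mul_mem (H.mul_mem hP hA) (H.inv_mem hP), ?_⟩
  rw [conj_smul_coe, exp_conj_coe, ← hAX]
  rfl

theorem lieOf_conjSubgroup (P : U d) (H : Subgroup (U d)) :
    lieOf (conjSubgroup P H) = conjSet P (lieOf H) := by
  have hinv : ((P⁻¹ : U d) : Matrix (Fin d) (Fin d) ℂ) * (P : Matrix (Fin d) (Fin d) ℂ) = 1 :=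
    congrArg Subtype.val (inv_mul_cancel P)
  have hinv' : (P : Matrix (Fin d) (Fin d) ℂ) * ((P⁻¹ : U d) : Matrix (Fin d) (Fin d) ℂ) = 1 :=
    congrArg Subtype.val (mul_inv_cancel P)
  ext X
  constructor
  · intro hX
    refine ⟨((P⁻¹ : U d) : Matrix (Fin d) (Fin d) ℂ) * X * P, fun t => ?_, ?_⟩
    · obtain ⟨_, ⟨A, hA, rfl⟩, hAX⟩ := hX t
      refine ⟨A, hA, ?_⟩
      have h := exp_conj_coe P⁻¹ (t • X)
      rw [inv_inv, ← hAX] at h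
      have h2 := conj_smul_coe P⁻¹ t X
      rw [inv_inv] at h2
      rw [h2, h]
      change _ = _ * ((P : Matrix (Fin d) (Fin d) ℂ) * A * (P⁻¹ : U d)) * _
      rw [mul_assoc, mul_assoc, mul_assoc, hinv, ← mul_assoc, ← mul_assoc, hinv]
      simp
    · change (P : Matrix (Fin d) (Fin d) ℂ) * _ * (P⁻¹ : U d) = X
      rw [mul_assoc, mul_assoc, mul_assoc, hinv', ← mul_assoc, ← mul_assoc, hinv']
      simp
  · rintro ⟨Y, hY, rfl⟩ t
    obtain ⟨A, hA, hAY⟩ := hY t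
    refine ⟨P * A * P⁻¹, ⟨A, hA, rfl⟩, ?_⟩
    change _ = NormedSpace.exp (t • ((P : Matrix (Fin d) (Fin d) ℂ) * Y * (P⁻¹ : U d)))
    rw [conj_smul_coe, exp_conj_coe, ← hAY]
    rfl

theorem add_mem_lieOf {H : Subgroup (U d)} (hH : IsClosed (H : Set (U d)))
    {X Y : Matrix (Fin d) (Fin d) ℂ} (hX : X ∈ lieOf H) (hY : Y ∈ lieOf H) : X + Y ∈ lieOf H := by
  choose A hA hAX using fun n : ℕ => hX (n : ℝ)⁻¹
  choose B hB hBY using fun n : ℕ => hY (n : ℝ)⁻¹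
  refine mem_lieOf_of_tendsto hH (l := atTop) (g := fun n => A n * B n) (a := fun n : ℕ => (n : ℝ))
    (fun n => H.mul_mem (hA n) (hB n)) tendsto_natCast_atTop_atTop ?_
  have h1 := tendsto_slope_exp X
  have h2 := tendsto_slope_exp Y
  have h3 := tendsto_exp_inv_smul Y
  -- Uses AB - 1 = (A - 1)B + (B - 1) with A = exp(X/n), B = exp(Y/n).
  have h4 := (h1.mul h3).add h2
  rw [mul_one] at h4
  refine h4.congr fun n => ?_
  rw [Submonoid.coe_mul, hAX, hBY, smul_mul_assoc, ← smul_add]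
  congr 1
  noncomm_ring

/-- The Lie algebra of a closed subgroup as a real vector space of matrices. -/
def lieSubmodule (H : Subgroup (U d)) (hH : IsClosed (H : Set (U d))) :
    Submodule ℝ (Matrix (Fin d) (Fin d) ℂ) where
  carrier := lieOf H
  zero_mem' := fun t => ⟨1, H.one_mem, by simp [NormedSpace.exp_zero]⟩
  add_mem' := add_mem_lieOf hH
  smul_mem' := fun s _ hX => smul_mem_lieOf hX s

/-! ### Block patterns given by an equivalence relation. -/

/-- The matrix is block-diagonal with respect to the classes of an equivalence relation. -/
def IsBlock (r : Setoid (Fin d)) (A : Matrix (Fin d) (Fin d) ℂ) : Prop :=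
  ∀ i j, ¬ r i j → A i j = 0

open Classical in
/-- The diagonal projection onto the coordinates equivalent to `i`. -/
def classProj (r : Setoid (Fin d)) (i : Fin d) : Matrix (Fin d) (Fin d) ℂ :=
  diagonal fun a => if r a i then 1 else 0

/-- As a commutation property, the block pattern passes at once to products, exponentials and the
functional calculus. -/
theorem isBlock_iff_commute {r : Setoid (Fin d)} {A : Matrix (Fin d) (Fin d) ℂ} :
    IsBlock r A ↔ ∀ i, Commute A (classProj r i) := by
  constructor
  · intro h i
    ext a b
    rw [classProj, mul_diagonal, diagonal_mul]
    by_cases hab : r a b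
    · have : r a i ↔ r b i := ⟨fun h => r.trans (r.symm hab) h, fun h => r.trans hab h⟩
      by_cases h : r b i <;> simp [this, h]
    · simp [h a b hab]
  · intro h a b hab
    have := congrFun (congrFun (h b).eq a) b
    rw [classProj, mul_diagonal, diagonal_mul] at this
    simpa [hab, r.refl] using this

theorem IsBlock.conjTranspose {r : Setoid (Fin d)} {A : Matrix (Fin d) (Fin d) ℂ}
    (hA : IsBlock r A) : IsBlock r Aᴴ := fun i j hij => by
  rw [conjTranspose_apply, hA j i fun h => hij (r.symm h), star_zero]

/-- The unitary matrices that are block-diagonal with respect to an equivalence relation. -/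
def relBlock (r : Setoid (Fin d)) : Subgroup (U d) where
  carrier := {A | IsBlock r (A : Matrix (Fin d) (Fin d) ℂ)}
  one_mem' := isBlock_iff_commute.2 fun _ => Commute.one_left _
  mul_mem' := fun hA hB => isBlock_iff_commute.2 fun i =>
    (isBlock_iff_commute.1 hA i).mul_left (isBlock_iff_commute.1 hB i)
  inv_mem' := fun hA => IsBlock.conjTranspose hA

theorem mem_relBlock {r : Setoid (Fin d)} {A : U d} :
    A ∈ relBlock r ↔ IsBlock r (A : Matrix (Fin d) (Fin d) ℂ) := Iff.rfl

theorem isClosed_relBlock (r : Setoid (Fin d)) : IsClosed (relBlock r : Set (U d)) := by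
  have : (relBlock r : Set (U d)) =
      ⋂ i, ⋂ j, ⋂ (_ : ¬ r i j), {A : U d | (A : Matrix (Fin d) (Fin d) ℂ) i j = 0} := by
    ext A
    simp [mem_relBlock, IsBlock]
  rw [this]
  refine isClosed_iInter fun i => isClosed_iInter fun j => isClosed_iInter fun _ => ?_
  exact isClosed_eq ((continuous_subtype_val.matrix_elem i j)) continuous_const

section Norm

open scoped Matrix.Norms.L2Operator

theorem IsBlock.exp {r : Setoid (Fin d)} {X : Matrix (Fin d) (Fin d) ℂ} (hX : IsBlock r X) :
    IsBlock r (NormedSpace.exp X) :=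
  let +nondep : NormedAlgebra ℚ (Matrix (Fin d) (Fin d) ℂ) := .restrictScalars ℚ ℂ _
  isBlock_iff_commute.2 fun i => (isBlock_iff_commute.1 hX i).exp_left

/-- A block-diagonal unitary matrix is the exponential of a block-diagonal skew-Hermitian one. -/
theorem exists_exp_eq_of_isBlock {r : Setoid (Fin d)} {A : U d} (hA : A ∈ relBlock r) :
    ∃ X ∈ u d, IsBlock r X ∧ (A : Matrix (Fin d) (Fin d) ℂ) = NormedSpace.exp X := by
  have hn : IsStarNormal (A : Matrix (Fin d) (Fin d) ℂ) := ⟨by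
    rw [commute_iff_eq, Unitary.star_mul_self_of_mem A.2, Unitary.mul_star_self_of_mem A.2]⟩
  -- A logarithm on the unit circle. Its jump at -1 is harmless: the spectrum is finite, so every
  -- function is continuous on it.
  set f : ℂ → ℂ := fun z => (z.arg : ℂ) * Complex.I with hf
  have hcont (g : ℂ → ℂ) : ContinuousOn g (spectrum ℂ (A : Matrix (Fin d) (Fin d) ℂ)) :=
    (finite_spectrum (A : Matrix (Fin d) (Fin d) ℂ)).continuousOn g
  refine ⟨cfc f (A : Matrix (Fin d) (Fin d) ℂ), ?_, ?_, ?_⟩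
  · change star (cfc f (A : Matrix (Fin d) (Fin d) ℂ)) = _
    rw [← cfc_star, ← cfc_neg]
    congr 1
    ext z
    simp [hf]
  · refine isBlock_iff_commute.2 fun i => Commute.cfc (isBlock_iff_commute.1 hA i) ?_ f
    exact isBlock_iff_commute.1 (IsBlock.conjTranspose hA) i
  · have h1 : IsStarNormal (cfc f (A : Matrix (Fin d) (Fin d) ℂ)) := cfc_predicate f _
    rw [← CFC.complex_exp_eq_normedSpace_exp,
      ← cfc_comp Complex.exp f _ hn Complex.continuous_exp.continuousOn (hcont f)]
    conv_lhs => rw [← cfc_id ℂ (A : Matrix (Fin d) (Fin d) ℂ)]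
    refine cfc_congr fun z hz => ?_
    have hz1 : ‖z‖ = 1 := by
      simpa using spectrum.subset_circle_of_unitary A.2 hz
    have := Complex.norm_mul_exp_arg_mul_I z
    rw [hz1] at this
    simpa [hf] using this.symm

end Norm

/-! ### Root vectors and the relation of linked coordinates. -/

/-- The elementary skew-Hermitian matrix `w E_{ij} - w̄ E_{ji}`. -/
def rot (i j : Fin d) (w : ℂ) : Matrix (Fin d) (Fin d) ℂ := single i j w - single j i (star w)

theorem rot_zero (i j : Fin d) : rot i j 0 = 0 := by simp [rot]

theorem rot_symm (i j : Fin d) (w : ℂ) : rot j i w = rot i j (-star w) := by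
  simp [rot, ← single_neg, add_comm, sub_eq_add_neg]

theorem smul_rot (i j : Fin d) (t : ℝ) (w : ℂ) : t • rot i j w = rot i j (t * w) := by
  simp [rot, smul_sub, smul_single]

/-- The right-hand side is X - Xᴴ, which is 2X by skew-Hermitian symmetry. -/
theorem two_smul_eq_sum_rot {X : Matrix (Fin d) (Fin d) ℂ} (hX : X ∈ u d) :
    (2 : ℝ) • X = ∑ i, ∑ j, rot i j (X i j) := by
  have hX' : Xᴴ = -X := hX
  simp only [rot, Finset.sum_sub_distrib]
  rw [← matrix_eq_sum_single X, Finset.sum_comm]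
  have := matrix_eq_sum_single Xᴴ
  simp only [conjTranspose_apply] at this
  rw [← this, hX', two_smul, sub_neg_eq_add]

theorem conj_diagPhase_apply (θ : Fin d → ℝ) (X : Matrix (Fin d) (Fin d) ℂ) (a b : Fin d) :
    ((diagPhase θ : Matrix (Fin d) (Fin d) ℂ) * X * ((diagPhase θ)⁻¹ : U d)) a b =
      Complex.exp ((θ a - θ b : ℝ) * Complex.I) * X a b := by
  have h : (((diagPhase θ)⁻¹ : U d) : Matrix (Fin d) (Fin d) ℂ) =
      diagonal fun j => Complex.exp (-(θ j * Complex.I)) := by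
    change (diagonal _)ᴴ = _
    rw [diagonal_conjTranspose]
    congr 1
    ext j
    simp [← Complex.exp_conj]
  rw [h, mul_diagonal]
  change ((diagonal _ : Matrix (Fin d) (Fin d) ℂ) * X) a b * _ = _
  rw [diagonal_mul, mul_right_comm, ← Complex.exp_add]
  congr 2
  push_cast
  ring

theorem diagonal_mem_lieOf {H : Subgroup (U d)} (hT : torusU d ⊆ (H : Set (U d)))
    (θ : Fin d → ℝ) : diagonal (fun j => (θ j : ℂ) * Complex.I) ∈ lieOf H := by
  intro t
  refine ⟨diagPhase (t • θ), hT ⟨_, rfl⟩, ?_⟩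
  rw [← diagonal_smul, Matrix.exp_diagonal]
  change diagonal _ = _
  congr 1
  ext j
  rw [Pi.coe_exp, ← Complex.exp_eq_exp_ℂ]
  simp [mul_assoc]

theorem rot_self_mem_lieOf {H : Subgroup (U d)} (hT : torusU d ⊆ (H : Set (U d)))
    (i : Fin d) (w : ℂ) : rot i i w ∈ lieOf H := by
  convert diagonal_mem_lieOf hT (Pi.single i (2 * w.im)) using 1
  ext a b
  by_cases hab : a = b
  · subst hab
    by_cases hi : i = a
    · subst hi
      simp [rot, Complex.ext_iff]
      ring
    · simp [rot, hi, Ne.symm hi]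
  · have : ¬ (i = a ∧ i = b) := fun h => hab (h.1.symm.trans h.2)
    simp [rot, hab, this]

/-- Conjugation by the reflection in coordinate i negates the entries with exactly one index equal
to i and fixes the others. -/
theorem sub_conj_reflection_apply (i : Fin d) (X : Matrix (Fin d) (Fin d) ℂ) (a b : Fin d) :
    (X - (diagPhase (Pi.single i Real.pi) : Matrix (Fin d) (Fin d) ℂ) * X *
      ((diagPhase (Pi.single i Real.pi))⁻¹ : U d)) a b =
      if a = i ↔ b = i then 0 else 2 * X a b := by
  have hpi : Complex.exp (-(Real.pi * Complex.I)) = -1 := by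
    rw [Complex.exp_neg, Complex.exp_pi_mul_I]; norm_num
  rw [Matrix.sub_apply, conj_diagPhase_apply]
  by_cases ha : a = i <;> by_cases hb : b = i <;> simp [ha, hb, hpi] <;> ring

/-- Coordinates `i` and `j` are linked when all of the root space of `(i, j)` is in `Lie H`. -/
def Linked (H : Subgroup (U d)) (i j : Fin d) : Prop := ∀ w, rot i j w ∈ lieOf H

/-- Torus conjugations isolate the (i, j) component of X, and further ones rotate its entry to any
phase; real scaling then fills the root space. -/
theorem linked_of_ne_zero {H : Subgroup (U d)} (hH : IsClosed (H : Set (U d)))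
    (hT : torusU d ⊆ (H : Set (U d))) {X : Matrix (Fin d) (Fin d) ℂ} (hX : X ∈ lieOf H)
    {i j : Fin d} (hij : X i j ≠ 0) : Linked H i j := by
  rcases eq_or_ne i j with rfl | hne
  · exact rot_self_mem_lieOf hT i
  have hXu : ∀ a b, star (X a b) = - X b a := fun a b =>
    congrFun (congrFun (show Xᴴ = -X from lieOf_le_u hX) b) a
  -- Reflecting in i and then in j leaves only the entries (i, j) and (j, i), each doubled twice.
  have key : rot i j (4 * X i j) ∈ lieSubmodule H hH := by
    have hZ := (lieSubmodule H hH).sub_mem hX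
      (conj_mem_lieOf hX (hT ⟨Pi.single i Real.pi, rfl⟩))
    have hW := (lieSubmodule H hH).sub_mem hZ
      (conj_mem_lieOf hZ (hT ⟨Pi.single j Real.pi, rfl⟩))
    convert hW using 1
    ext a b
    rw [sub_conj_reflection_apply, sub_conj_reflection_apply]
    simp only [rot, Matrix.sub_apply, single_apply, star_mul', hXu]
    have hne' := hne.symm
    by_cases h1 : a = i
    · subst h1
      by_cases h2 : b = j
      · subst h2
        simp [hne, hne']
        ring
      · simp [hne, hne', h2, Ne.symm h2]
    · by_cases h2 : a = j
      · subst h2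
        by_cases h3 : b = i
        · subst h3
          simp [hne, hne']
          ring
        · simp [hne, hne', h3, Ne.symm h3]
      · simp only [h1, h2, Ne.symm h1, Ne.symm h2, false_and, if_false, sub_zero, false_iff]
        by_cases h3 : b = i
        · subst h3
          simp [hne]
        · simp [h3]
  intro w
  have hw := conj_mem_lieOf key (hT ⟨Pi.single i (w / (4 * X i j)).arg, rfl⟩)
  convert smul_mem_lieOf hw ‖w / (4 * X i j)‖ using 1
  have h4 : 4 * X i j ≠ 0 := mul_ne_zero (by norm_num) hij
  have hpol := Complex.norm_mul_exp_arg_mul_I (w / (4 * X i j))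
  have hrot : (diagPhase (Pi.single i (w / (4 * X i j)).arg) : Matrix (Fin d) (Fin d) ℂ) *
      rot i j (4 * X i j) * ((diagPhase (Pi.single i (w / (4 * X i j)).arg))⁻¹ : U d) =
      rot i j (Complex.exp ((w / (4 * X i j)).arg * Complex.I) * (4 * X i j)) := by
    ext a b
    rw [conj_diagPhase_apply]
    by_cases h : a = i ∧ b = j
    · obtain ⟨rfl, rfl⟩ := h
      simp [rot, hne]
    · by_cases h' : a = j ∧ b = i
      · obtain ⟨rfl, rfl⟩ := h'
        simp [rot, hne, ← Complex.exp_conj]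
      · have h1 : ¬ (i = a ∧ j = b) := fun e => h ⟨e.1.symm, e.2.symm⟩
        have h2 : ¬ (j = a ∧ i = b) := fun e => h' ⟨e.1.symm, e.2.symm⟩
        simp [rot, h1, h2]
  rw [hrot, smul_rot, ← mul_assoc, hpol, div_mul_cancel₀ _ h4]

/-- The bracket is the limit of n(exp(X/n) Y exp(-X/n) - Y). These matrices lie in Lie(H), which is
topologically closed as a finite-dimensional subspace. -/
theorem lie_mem_lieOf {H : Subgroup (U d)} (hH : IsClosed (H : Set (U d)))
    {X Y : Matrix (Fin d) (Fin d) ℂ} (hX : X ∈ lieOf H) (hY : Y ∈ lieOf H) :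
    ⁅X, Y⁆ ∈ lieOf H := by
  have h1 := tendsto_slope_exp X
  have h2 := tendsto_slope_exp (-X)
  have h3 := tendsto_exp_inv_smul (-X)
  have h4 := ((h1.mul_const Y).mul h3).add (h2.const_mul Y)
  have hXY : X * Y * 1 + Y * -X = ⁅X, Y⁆ := by rw [Ring.lie_def]; noncomm_ring
  rw [hXY] at h4
  refine (lieSubmodule H hH).closed_of_finiteDimensional.mem_of_tendsto h4
    (Eventually.of_forall fun n => ?_)
  obtain ⟨A, hA, hAX⟩ := hX (n : ℝ)⁻¹
  have hinv := coe_inv_exp hAX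
  have := (lieSubmodule H hH).smul_mem (n : ℝ)
    ((lieSubmodule H hH).sub_mem (conj_mem_lieOf hY hA) hY)
  refine (congrArg (· ∈ lieSubmodule H hH) ?_).mpr this
  rw [smul_neg, ← hinv, ← hAX, smul_mul_assoc, smul_mul_assoc, mul_smul_comm, ← smul_add]
  congr 1
  noncomm_ring

/-- For a closed subgroup containing the maximal torus, being linked is an equivalence relation. -/
def linkedSetoid (H : Subgroup (U d)) (hH : IsClosed (H : Set (U d)))
    (hT : torusU d ⊆ (H : Set (U d))) : Setoid (Fin d) where
  r := Linked H
  iseqv :=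
    { refl := rot_self_mem_lieOf hT
      symm := fun h w => by rw [rot_symm]; exact h _
      trans := by
        intro i j k hij hjk
        rcases eq_or_ne i k with rfl | hik
        · exact rot_self_mem_lieOf hT i
        rcases eq_or_ne i j with rfl | hij'
        · exact hjk
        rcases eq_or_ne j k with rfl | hjk'
        · exact hij
        -- For distinct i, j, k, the bracket [E_ij - E_ji, E_jk - E_kj] has (i, k) entry 1.
        refine linked_of_ne_zero hH hT (lie_mem_lieOf hH (hij 1) (hjk 1)) ?_
        simp [Ring.lie_def, rot, sub_mul, mul_sub, hik, hij', hjk', hij'.symm, hik.symm,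
          hjk'.symm] }

theorem mem_lieOf_of_isBlock {H : Subgroup (U d)} (hH : IsClosed (H : Set (U d)))
    (hT : torusU d ⊆ (H : Set (U d))) {X : Matrix (Fin d) (Fin d) ℂ} (hX : X ∈ u d)
    (hb : IsBlock (linkedSetoid H hH hT) X) : X ∈ lieOf H := by
  have h2 : (2 : ℝ) • X ∈ lieSubmodule H hH := by
    rw [two_smul_eq_sum_rot hX]
    refine Submodule.sum_mem _ fun i _ => Submodule.sum_mem _ fun j _ => ?_
    by_cases hij : linkedSetoid H hH hT i j
    · exact hij _
    · rw [hb i j hij, rot_zero]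
      exact Submodule.zero_mem _
  simpa using smul_mem_lieOf h2 (1 / 2)

theorem relBlock_le {H : Subgroup (U d)} (hH : IsClosed (H : Set (U d)))
    (hT : torusU d ⊆ (H : Set (U d))) : relBlock (linkedSetoid H hH hT) ≤ H := by
  intro A hA
  obtain ⟨X, hX, hb, hAX⟩ := exists_exp_eq_of_isBlock hA
  obtain ⟨B, hB, hBX⟩ := mem_lieOf_of_isBlock hH hT hX hb 1
  rw [one_smul] at hBX
  exact (Subtype.ext (hAX.trans hBX.symm) : A = B) ▸ hB

/-! ### The real trace as a distance to the identity, and the local structure of H. -/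

theorem re_trace_conjTranspose_mul_self (X : Matrix (Fin d) (Fin d) ℂ) :
    (Xᴴ * X).trace.re = ∑ i, ∑ j, ‖X j i‖ ^ 2 := by
  simp [trace, mul_apply, ← Complex.normSq_eq_norm_sq, Complex.normSq_apply]

theorem norm_sq_apply_le (X : Matrix (Fin d) (Fin d) ℂ) (i j : Fin d) :
    ‖X i j‖ ^ 2 ≤ (Xᴴ * X).trace.re := by
  rw [re_trace_conjTranspose_mul_self]
  calc ‖X i j‖ ^ 2 ≤ ∑ k, ‖X k j‖ ^ 2 :=
        Finset.single_le_sum (f := fun k => ‖X k j‖ ^ 2) (fun _ _ => by positivity)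
          (Finset.mem_univ i)
    _ ≤ _ := Finset.single_le_sum (f := fun j => ∑ k, ‖X k j‖ ^ 2) (fun _ _ => by positivity)
          (Finset.mem_univ j)

/-- The left side is the squared Frobenius distance from A to 1, so maximising Re tr means getting
as close to 1 as possible. -/
theorem re_trace_sub_one (A : U d) :
    ((((A : Matrix (Fin d) (Fin d) ℂ) - 1)ᴴ * ((A : Matrix (Fin d) (Fin d) ℂ) - 1)).trace).re =
      2 * (d - (A : Matrix (Fin d) (Fin d) ℂ).trace.re) := by
  have h : (A : Matrix (Fin d) (Fin d) ℂ)ᴴ * A = 1 := Unitary.star_mul_self_of_mem A.2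
  rw [conjTranspose_sub, conjTranspose_one, sub_mul, mul_sub, h]
  simp [trace_conjTranspose]
  ring

/-- Unitary matrices whose traces tend to `d` tend to the identity. -/
theorem tendsto_one_of_trace {g : ℕ → U d}
    (h : Tendsto (fun n => (g n : Matrix (Fin d) (Fin d) ℂ).trace.re) atTop (𝓝 d)) :
    Tendsto (fun n => (g n : Matrix (Fin d) (Fin d) ℂ)) atTop (𝓝 1) := by
  have h0 : Tendsto (fun n => (g n : Matrix (Fin d) (Fin d) ℂ) - 1) atTop (𝓝 0) := by
    refine tendsto_pi_nhds.2 fun i => tendsto_pi_nhds.2 fun j => ?_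
    have h1 : Tendsto (fun n => √(2 * (d - (g n : Matrix (Fin d) (Fin d) ℂ).trace.re))) atTop
        (𝓝 0) := by
      have := ((h.const_sub (d : ℝ)).const_mul 2).sqrt
      simpa using this
    refine squeeze_zero_norm (fun n => ?_) h1
    rw [← re_trace_sub_one]
    exact Real.le_sqrt_of_sq_le (norm_sq_apply_le _ i j)
  simpa using h0.add_const 1

theorem re_trace_eq_zero {X : Matrix (Fin d) (Fin d) ℂ} (hX : X ∈ u d) : X.trace.re = 0 := by
  have h : star X.trace = -X.trace := by
    rw [← trace_conjTranspose, show Xᴴ = -X from hX, trace_neg]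
  have := congrArg Complex.re h
  simp at this
  linarith

section Norm

open scoped Matrix.Norms.L2Operator

/-- First-order condition at a maximum of `b ↦ Re tr (b g)` on a block-diagonal group. -/
theorem re_trace_mul_eq_zero {r : Setoid (Fin d)} {g : U d}
    (hg : ∀ b ∈ relBlock r, ((b : Matrix (Fin d) (Fin d) ℂ) * g).trace.re ≤
      (g : Matrix (Fin d) (Fin d) ℂ).trace.re)
    {X : Matrix (Fin d) (Fin d) ℂ} (hX : X ∈ u d) (hb : IsBlock r X) :
    (X * ((g : Matrix (Fin d) (Fin d) ℂ) - 1)).trace.re = 0 := by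
  let L : Matrix (Fin d) (Fin d) ℂ →ₗ[ℝ] ℝ :=
    Complex.reLm ∘ₗ (Matrix.traceLinearMap (Fin d) ℂ ℂ).restrictScalars ℝ ∘ₗ
      (LinearMap.mulRight ℝ (g : Matrix (Fin d) (Fin d) ℂ))
  have hL (Y) : L Y = (Y * (g : Matrix (Fin d) (Fin d) ℂ)).trace.re := rfl
  have hd : HasDerivAt (fun t : ℝ => L (NormedSpace.exp (t • X))) (L X) 0 :=
    (LinearMap.toContinuousLinearMap L).hasFDerivAt.comp_hasDerivAt 0 (hasDerivAt_exp_smul_zero X)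
  have hmax : IsLocalMax (fun t : ℝ => L (NormedSpace.exp (t • X))) 0 := by
    refine Eventually.of_forall fun t => ?_
    have hu : t • X ∈ u d := (u d).smul_mem t hX
    have hbt : IsBlock r (t • X) := fun i j hij => by simp [hb i j hij]
    simpa [hL, NormedSpace.exp_zero] using hg ⟨_, exp_mem_unitaryGroup hu⟩ hbt.exp
  have := hmax.hasDerivAt_eq_zero hd
  rw [hL] at this
  -- Since Re tr X = 0, g may be replaced by g - 1, the form that survives rescaling to a limit
  -- direction.
  rw [mul_sub, mul_one, trace_sub, Complex.sub_re, this, re_trace_eq_zero hX, sub_zero]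

/-- A sequence of unitary matrices tending to `1` has a limit direction, along a subsequence. -/
theorem exists_tendsto_direction {g : ℕ → U d} (hne : ∀ n, g n ≠ 1)
    (h : Tendsto (fun n => (g n : Matrix (Fin d) (Fin d) ℂ)) atTop (𝓝 1)) :
    ∃ (a : ℕ → ℝ) (φ : ℕ → ℕ) (X : Matrix (Fin d) (Fin d) ℂ), X ≠ 0 ∧ Tendsto a atTop atTop ∧
      Tendsto (fun n => a n • ((g (φ n) : Matrix (Fin d) (Fin d) ℂ) - 1)) atTop (𝓝 X) := by
  have : ProperSpace (Matrix (Fin d) (Fin d) ℂ) := FiniteDimensional.proper ℂ _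
  have hne' (n) : ‖(g n : Matrix (Fin d) (Fin d) ℂ) - 1‖ ≠ 0 :=
    norm_ne_zero_iff.2 (sub_ne_zero.2 fun h => hne n (Subtype.ext h))
  -- The normalised differences lie on the compact unit sphere; the factors a n are inverse
  -- distances to 1.
  obtain ⟨X, hX, φ, hφ, hlim⟩ :=
    (isCompact_sphere (0 : Matrix (Fin d) (Fin d) ℂ) 1).tendsto_subseq
      (x := fun n => ‖(g n : Matrix (Fin d) (Fin d) ℂ) - 1‖⁻¹ •
        ((g n : Matrix (Fin d) (Fin d) ℂ) - 1))
      (fun n => by simp [norm_smul, hne' n])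
  refine ⟨fun n => ‖(g (φ n) : Matrix (Fin d) (Fin d) ℂ) - 1‖⁻¹, φ, X, ?_, ?_, hlim⟩
  · rintro rfl
    simp at hX
  · have h0 : Tendsto (fun n => ‖(g (φ n) : Matrix (Fin d) (Fin d) ℂ) - 1‖) atTop (𝓝[>] 0) := by
      rw [tendsto_nhdsWithin_iff]
      refine ⟨?_, Eventually.of_forall fun n => (norm_nonneg _).lt_of_ne' (hne' _)⟩
      have := ((h.comp hφ.tendsto_atTop).sub_const 1).norm
      simpa using this
    exact tendsto_inv_nhdsGT_zero.comp h0

end Norm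

instance firstCountableTopology_U : FirstCountableTopology (U d) :=
  have : FirstCountableTopology (Matrix (Fin d) (Fin d) ℂ) :=
    inferInstanceAs (FirstCountableTopology (Fin d → Fin d → ℂ))
  Topology.IsInducing.subtypeVal.firstCountableTopology

theorem isBlock_of_mem_lieOf {H : Subgroup (U d)} (hH : IsClosed (H : Set (U d)))
    (hT : torusU d ⊆ (H : Set (U d))) {X : Matrix (Fin d) (Fin d) ℂ} (hX : X ∈ lieOf H) :
    IsBlock (linkedSetoid H hH hT) X := fun i j hij => by
  by_contra hne
  exact hij (linked_of_ne_zero hH hT hX hne)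

/-- Near the identity, a closed subgroup containing the maximal torus is block-diagonal. -/
theorem eventually_mem_relBlock {H : Subgroup (U d)} (hH : IsClosed (H : Set (U d)))
    (hT : torusU d ⊆ (H : Set (U d))) :
    ∀ᶠ g in 𝓝 (1 : U d), g ∈ H → g ∈ relBlock (linkedSetoid H hH hT) := by
  set B := relBlock (linkedSetoid H hH hT) with hB
  have hBH : B ≤ H := relBlock_le hH hT
  by_contra hcon
  obtain ⟨g, hg1, hg⟩ := exists_seq_forall_of_frequently (not_eventually.1 hcon)
  push Not at hg
  -- Take the point of the coset B · g n closest to 1, which exists by compactness of B. It stays in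
  -- H and outside B, and is no farther from 1 than g n.
  have hmax (n : ℕ) : ∃ h : U d, h ∈ H ∧ h ∉ B ∧
      (∀ b ∈ B, ((b : Matrix (Fin d) (Fin d) ℂ) * h).trace.re ≤
        (h : Matrix (Fin d) (Fin d) ℂ).trace.re) ∧
      (g n : Matrix (Fin d) (Fin d) ℂ).trace.re ≤ (h : Matrix (Fin d) (Fin d) ℂ).trace.re := by
    obtain ⟨k, hk, hkmax⟩ := (isClosed_relBlock (linkedSetoid H hH hT)).isCompact.exists_isMaxOn
      ⟨1, B.one_mem⟩ (f := fun k : U d => ((k * g n : U d) : Matrix (Fin d) (Fin d) ℂ).trace.re)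
      (Complex.continuous_re.comp
        (continuous_subtype_val.comp (continuous_mul_const (g n))).matrix_trace).continuousOn
    refine ⟨k * g n, H.mul_mem (hBH hk) (hg n).1, fun h => (hg n).2 ?_, fun b hb => ?_, ?_⟩
    · exact (B.mul_mem_cancel_left hk).1 h
    · have := hkmax (B.mul_mem hb hk)
      simpa [mul_assoc] using this
    · have := hkmax B.one_mem
      simpa using this
  choose h hhH hhB hhmax hhge using hmax
  have hle (A : U d) : (A : Matrix (Fin d) (Fin d) ℂ).trace.re ≤ d := by
    have h1 := re_trace_sub_one A
    have h2 : 0 ≤ ((((A : Matrix (Fin d) (Fin d) ℂ) - 1)ᴴ *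
        ((A : Matrix (Fin d) (Fin d) ℂ) - 1)).trace).re := by
      rw [re_trace_conjTranspose_mul_self]
      positivity
    linarith
  have hgt : Tendsto (fun n => (g n : Matrix (Fin d) (Fin d) ℂ).trace.re) atTop (𝓝 d) := by
    have hc : Continuous fun A : U d => (A : Matrix (Fin d) (Fin d) ℂ).trace.re :=
      Complex.continuous_re.comp continuous_subtype_val.matrix_trace
    have := (hc.tendsto 1).comp hg1
    simpa [Function.comp_def] using this
  have hlim := tendsto_one_of_trace
    (tendsto_of_tendsto_of_tendsto_of_le_of_le hgt tendsto_const_nhds hhge fun n => hle (h n))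
  obtain ⟨a, φ, X, hX0, ha, hX⟩ := exists_tendsto_direction
    (fun n hn => hhB n (by rw [hn]; exact B.one_mem)) hlim
  have hXH : X ∈ lieOf H := mem_lieOf_of_tendsto hH (fun n => hhH (φ n)) ha hX
  have hXu := lieOf_le_u hXH
  have hzero (n : ℕ) : (X * (a n • ((h (φ n) : Matrix (Fin d) (Fin d) ℂ) - 1))).trace.re = 0 := by
    rw [mul_smul_comm, trace_smul, Complex.smul_re,
      re_trace_mul_eq_zero (hhmax (φ n)) hXu (isBlock_of_mem_lieOf hH hT hXH), smul_zero]
  -- X is itself an admissible direction in the first-order condition; in the limit X is orthogonal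
  -- to itself, and Re tr(X²) = -‖X‖² in the Frobenius norm.
  have hXX : (X * X).trace.re = 0 := by
    have hc : Continuous fun Y : Matrix (Fin d) (Fin d) ℂ => (X * Y).trace.re :=
      Complex.continuous_re.comp (continuous_const.matrix_mul continuous_id).matrix_trace
    refine tendsto_nhds_unique ((hc.tendsto X).comp hX) ?_
    simp only [Function.comp_def, hzero]
    exact tendsto_const_nhds
  apply hX0
  ext i j
  have h1 := norm_sq_apply_le X i j
  rw [show Xᴴ = -X from hXu, neg_mul, trace_neg, Complex.neg_re, hXX, neg_zero] at h1
  have h2 : ‖X i j‖ = 0 := by nlinarith [norm_nonneg (X i j)]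
  simpa using h2

/-- A connected closed subgroup of `U(d)` containing the maximal torus consists of all unitary
matrices that are block-diagonal for some partition of the coordinates. -/
theorem exists_eq_relBlock {H : Subgroup (U d)} (hH : IsClosed (H : Set (U d)))
    (hconn : IsConnected (H : Set (U d))) (hT : torusU d ⊆ (H : Set (U d))) :
    ∃ r : Setoid (Fin d), H = relBlock r := by
  refine ⟨linkedSetoid H hH hT, le_antisymm ?_ (relBlock_le hH hT)⟩
  set B := relBlock (linkedSetoid H hH hT) with hB
  have : ConnectedSpace H := isConnected_iff_connectedSpace.1 hconn
  -- A subgroup containing a neighbourhood of 1 is open, hence also closed, hence all of the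
  -- connected group H.
  have hopen : IsOpen (B.subgroupOf H : Set H) := by
    refine Subgroup.isOpen_of_mem_nhds _ (g := 1) ?_
    have := (continuous_subtype_val.tendsto (1 : H)).eventually (eventually_mem_relBlock hH hT)
    filter_upwards [this] with g hg
    exact hg g.2
  have hclopen : IsClopen (B.subgroupOf H : Set H) := ⟨Subgroup.isClosed_of_isOpen _ hopen, hopen⟩
  have huniv := hclopen.eq_univ ⟨1, Subgroup.one_mem _⟩
  intro g hg
  have : (⟨g, hg⟩ : H) ∈ (B.subgroupOf H : Set H) := huniv ▸ Set.mem_univ _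
  exact this

/-! ### From equivalence relations to compositions and permutations. -/

/-- The equivalence relation on `Fin d` whose classes are the blocks of a composition. -/
def blockSetoid (c : Composition d) : Setoid (Fin d) :=
  Setoid.ker fun k => (c.blocksFinEquiv.symm k).1

theorem blockSetoid_iff {c : Composition d} {k l : Fin d} : blockSetoid c k l ↔
    (c.blocksFinEquiv.symm k).1 = (c.blocksFinEquiv.symm l).1 := Iff.rfl

theorem isBlock_blockDiag (c : Composition d)
    (A : ∀ j : Fin c.length, Matrix (Fin (c.blocksFun j)) (Fin (c.blocksFun j)) ℂ) :
    IsBlock (blockSetoid c) (blockDiag c A) := fun _ _ hkl => blockDiagonal'_apply_ne A _ _ hkl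

theorem isBlock_blockSetoid_iff {c : Composition d} {X : Matrix (Fin d) (Fin d) ℂ} :
    IsBlock (blockSetoid c) X ↔ ∃ A, X = blockDiag c A := by
  refine ⟨fun h => ⟨blockDiag' (reindex c.blocksFinEquiv.symm c.blocksFinEquiv.symm X), ?_⟩, ?_⟩
  · ext k l
    obtain ⟨⟨i, a⟩, rfl⟩ := c.blocksFinEquiv.surjective k
    obtain ⟨⟨j, b⟩, rfl⟩ := c.blocksFinEquiv.surjective l
    by_cases hij : i = j
    · subst hij
      simp [blockDiag, blockDiag'_apply]
    · have h1 : ¬ blockSetoid c (c.blocksFinEquiv ⟨i, a⟩) (c.blocksFinEquiv ⟨j, b⟩) := by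
        simpa [blockSetoid_iff] using hij
      rw [h _ _ h1, isBlock_blockDiag c _ _ _ h1]
  · rintro ⟨A, rfl⟩
    exact isBlock_blockDiag c A

theorem blockDiag_injective (c : Composition d) : Function.Injective (blockDiag c) := fun _ _ h =>
  blockDiagonal'_injective ((reindex c.blocksFinEquiv c.blocksFinEquiv).injective h)

theorem blockU_eq_relBlock (c : Composition d) : blockU c = relBlock (blockSetoid c) := by
  ext A
  rw [mem_relBlock, isBlock_blockSetoid_iff]
  constructor
  · rintro ⟨B, rfl⟩
    exact ⟨_, rfl⟩
  · rintro ⟨B, hB⟩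
    have hU : ∀ j, B j ∈ unitaryGroup (Fin (c.blocksFun j)) ℂ := by
      have h1 : (A : Matrix (Fin d) (Fin d) ℂ) * star (A : Matrix (Fin d) (Fin d) ℂ) = 1 :=
        mem_unitaryGroup_iff.1 A.2
      rw [hB, star_eq_conjTranspose, blockDiag_conjTranspose, ← blockDiag_mul,
        ← blockDiag_one c] at h1
      intro j
      rw [mem_unitaryGroup_iff]
      exact congrFun (blockDiag_injective c h1) j
    exact ⟨fun j => ⟨B j, hU j⟩, Subtype.ext hB.symm⟩

theorem exists_composition (r : Setoid (Fin d)) :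
    ∃ (c : Composition d) (e : Fin c.length ≃ Quotient r),
      ∀ j, c.blocksFun j = Nat.card {i : Fin d // Quotient.mk r i = e j} := by
  classical
  let n := Nat.card (Quotient r)
  let e : Fin n ≃ Quotient r := (Finite.equivFin _).symm
  let f : Fin n → ℕ := fun j => Nat.card {i : Fin d // Quotient.mk r i = e j}
  have hpos (j) : 0 < f j := by
    obtain ⟨i, hi⟩ := Quotient.exists_rep (e j)
    have : Nonempty {i : Fin d // Quotient.mk r i = e j} := ⟨⟨i, hi⟩⟩
    exact Nat.card_pos
  have hsum : ∑ j, f j = d := by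
    calc ∑ j, f j = ∑ q, Nat.card {i : Fin d // Quotient.mk r i = q} :=
          e.sum_comp fun q => Nat.card {i : Fin d // Quotient.mk r i = q}
      _ = Nat.card (Σ q, {i : Fin d // Quotient.mk r i = q}) := Nat.card_sigma.symm
      _ = d := by rw [Nat.card_congr (Equiv.sigmaFiberEquiv _), Nat.card_fin]
  let c : Composition d := ⟨List.ofFn f, by simpa using fun j => hpos j, by
    rw [List.sum_ofFn, hsum]⟩
  have hlen : c.length = n := List.length_ofFn
  refine ⟨c, (finCongr hlen).trans e, fun j => ?_⟩
  change (List.ofFn f).get j = f (Fin.cast hlen j)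
  rw [List.get_ofFn]

/-- Blocks and classes are matched in size; gluing bijections of each block with its class gives a
permutation listing the coordinates class by class. -/
theorem exists_perm (r : Setoid (Fin d)) :
    ∃ (c : Composition d) (σ : Equiv.Perm (Fin d)), ∀ k l, blockSetoid c k l ↔ r (σ k) (σ l) := by
  obtain ⟨c, e, he⟩ := exists_composition r
  let F (j : Fin c.length) : Fin (c.blocksFun j) ≃ {i : Fin d // Quotient.mk r i = e j} :=
    (finCongr (he j)).trans (Finite.equivFin _).symm
  let E : (Σ j : Fin c.length, Fin (c.blocksFun j)) ≃ Fin d :=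
    ((Equiv.sigmaCongrRight F).trans (Equiv.sigmaCongrLeft
      (β := fun q => {i : Fin d // Quotient.mk r i = q}) e)).trans
      (Equiv.sigmaFiberEquiv (Quotient.mk r))
  have hE (x) : Quotient.mk r (E x) = e x.1 := (F x.1 x.2).2
  refine ⟨c, c.blocksFinEquiv.symm.trans E, fun k l => ?_⟩
  rw [← Quotient.eq (r := r)]
  simp [hE, blockSetoid_iff]

theorem permU_conj_apply (σ : Equiv.Perm (Fin d)) (A : U d) (k l : Fin d) :
    ((permU σ * A * (permU σ)⁻¹ : U d) : Matrix (Fin d) (Fin d) ℂ) k l =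
      (A : Matrix (Fin d) (Fin d) ℂ) (σ k) (σ l) := by
  change (σ.permMatrix ℂ * (A : Matrix (Fin d) (Fin d) ℂ) * (σ.permMatrix ℂ)ᴴ) k l = _
  rw [conjTranspose_permMatrix]
  simp [Equiv.Perm.permMatrix, PEquiv.toMatrix_toPEquiv_mul, PEquiv.mul_toMatrix_toPEquiv]
  rfl

theorem conjSubgroup_relBlock {r s : Setoid (Fin d)} {σ : Equiv.Perm (Fin d)}
    (h : ∀ k l, s k l ↔ r (σ k) (σ l)) : conjSubgroup (permU σ) (relBlock r) = relBlock s := by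
  have key (A : U d) : permU σ * A * (permU σ)⁻¹ ∈ relBlock s ↔ A ∈ relBlock r := by
    simp only [mem_relBlock, IsBlock, permU_conj_apply, h]
    constructor
    · intro H i j hij
      simpa using H (σ.symm i) (σ.symm j) (by simpa using hij)
    · exact fun H i j hij => H _ _ hij
  ext A
  constructor
  · rintro ⟨B, hB, rfl⟩
    exact (key B).2 hB
  · intro hA
    have hA' : A = permU σ * ((permU σ)⁻¹ * A * permU σ) * (permU σ)⁻¹ := by group
    exact ⟨(permU σ)⁻¹ * A * permU σ, (key _).1 (hA' ▸ hA), hA'.symm⟩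

theorem conjSubgroup_inf_SU (P : U d) (H : Subgroup (U d)) :
    conjSubgroup P (H ⊓ SU d) = conjSubgroup P H ⊓ SU d := by
  have hn : (SU d).Normal := MonoidHom.normal_ker _
  rw [conjSubgroup, Subgroup.map_inf _ _ _ (MulAut.conj P).injective]
  congr 1
  exact Subgroup.Normal.map_conj_eq (SU d) P

/-- Take S to be the class of j, which misses i: column l of a block matrix is supported on the
class of l. -/
theorem preservesCoordSubspace_of_le_relBlock {H : Subgroup (U d)} {r : Setoid (Fin d)}
    (h : H ≤ relBlock r) {i j : Fin d} (hij : ¬ r i j) : PreservesCoordSubspace H := by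
  refine ⟨{k | r k j}, ⟨j, r.refl j⟩, fun h => hij (h ▸ Set.mem_univ i : i ∈ {k | r k j}), ?_⟩
  intro A hA v hv
  have hle : coordSubspace {k | r k j} ≤
      (coordSubspace {k | r k j}).comap (mulVecLin (A : Matrix (Fin d) (Fin d) ℂ)) := by
    refine Submodule.span_le.2 ?_
    rintro _ ⟨l, hl, rfl⟩
    change (A : Matrix (Fin d) (Fin d) ℂ) *ᵥ _ ∈ coordSubspace {k | r k j}
    rw [mulVec_single_one, pi_eq_sum_univ' ((A : Matrix (Fin d) (Fin d) ℂ).col l)]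
    refine Submodule.sum_mem _ fun k _ => ?_
    by_cases hk : r k l
    · refine Submodule.smul_mem _ _ (Submodule.subset_span ⟨k, r.trans hk hl, ?_⟩)
      ext m
      simp [Pi.single_apply, eq_comm]
    · rw [col_apply, h hA k l hk, zero_smul]
      exact Submodule.zero_mem _
  exact hle hv

theorem relBlock_eq_top {r : Setoid (Fin d)} (h : ∀ i j, r i j) : relBlock r = ⊤ :=
  top_unique fun _ _ i j hij => absurd (h i j) hij

/-! ### Lie algebras of the block groups and of `SU(d)`. -/

theorem isBlock_of_mem_lieOf_relBlock {r : Setoid (Fin d)} {X : Matrix (Fin d) (Fin d) ℂ}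
    (hX : X ∈ lieOf (relBlock r)) : IsBlock r X := by
  intro i j hij
  have h := (continuous_id.matrix_elem i j).continuousAt.tendsto.comp (tendsto_slope_exp X)
  refine tendsto_nhds_unique h ?_
  have h0 (n : ℕ) : ((n : ℝ) • (NormedSpace.exp ((n : ℝ)⁻¹ • X) - 1)) i j = 0 := by
    obtain ⟨A, hA, hAX⟩ := hX (n : ℝ)⁻¹
    have hij' : i ≠ j := fun h => hij (h ▸ r.refl i)
    rw [← hAX]
    simp [hA i j hij, hij']
  simp only [Function.comp_def, id, h0]
  exact tendsto_const_nhds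

theorem lieOf_relBlock (r : Setoid (Fin d)) : lieOf (relBlock r) = {X | X ∈ u d ∧ IsBlock r X} := by
  ext X
  refine ⟨fun hX => ⟨lieOf_le_u hX, isBlock_of_mem_lieOf_relBlock hX⟩, fun ⟨hX, hb⟩ t => ?_⟩
  have hbt : IsBlock r (t • X) := fun i j hij => by simp [hb i j hij]
  exact ⟨⟨_, exp_mem_unitaryGroup ((u d).smul_mem t hX)⟩, hbt.exp, rfl⟩

theorem exists_diagonalization {X : Matrix (Fin d) (Fin d) ℂ} (hX : X ∈ u d) :
    ∃ (V : U d) (v : Fin d → ℂ), X = (V : Matrix (Fin d) (Fin d) ℂ) * diagonal v * (V⁻¹ : U d) := by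
  have hX' : Xᴴ = -X := hX
  have hY : (-Complex.I • X).IsHermitian := by
    rw [IsHermitian, conjTranspose_smul, hX']
    simp
  refine ⟨hY.eigenvectorUnitary, Complex.I • (RCLike.ofReal ∘ hY.eigenvalues), ?_⟩
  have h1 : X = Complex.I • (-Complex.I • X) := by simp [smul_smul]
  rw [diagonal_smul, mul_smul_comm, smul_mul_assoc]
  conv_lhs => rw [h1, hY.spectral_theorem]
  rfl

/-- A skew-Hermitian X is unitarily diagonalisable because -iX is Hermitian; for diagonal matrices
the identity is exp of a sum. -/
theorem det_exp_of_mem_u {X : Matrix (Fin d) (Fin d) ℂ} (hX : X ∈ u d) :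
    (NormedSpace.exp X).det = Complex.exp X.trace := by
  obtain ⟨V, v, rfl⟩ := exists_diagonalization hX
  have hinv : ((V⁻¹ : U d) : Matrix (Fin d) (Fin d) ℂ) * (V : Matrix (Fin d) (Fin d) ℂ) = 1 :=
    congrArg Subtype.val (inv_mul_cancel V)
  rw [exp_conj_coe, det_mul_comm, ← mul_assoc, hinv, one_mul, trace_mul_cycle, hinv, one_mul,
    trace_diagonal, Complex.exp_sum, Matrix.exp_diagonal, det_diagonal]
  simp [Pi.coe_exp, Complex.exp_eq_exp_ℂ]

theorem lieOf_SU : lieOf (SU d) = {X | X ∈ su d} := by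
  have hdet (X : Matrix (Fin d) (Fin d) ℂ) (hX : X ∈ u d) (t : ℝ) :
      (NormedSpace.exp (t • X)).det = Complex.exp (t * X.trace) := by
    rw [det_exp_of_mem_u ((u d).smul_mem t hX), trace_smul, Complex.real_smul]
  ext X
  constructor
  · intro hX
    have hXu := lieOf_le_u hX
    refine ⟨hXu, ?_⟩
    have h1 : ∀ t : ℝ, Complex.exp (t * X.trace) = 1 := fun t => by
      obtain ⟨A, hA, hAX⟩ := hX t
      rw [← hdet X hXu, ← hAX]
      exact hA
    -- The function exp(t tr X) is constantly 1, so its derivative tr X at 0 vanishes.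
    have h2 : HasDerivAt (fun t : ℝ => Complex.exp (t * X.trace)) X.trace 0 := by
      have h3 : HasDerivAt (fun t : ℝ => (t : ℂ) * X.trace) X.trace 0 := by
        simpa using (Complex.ofRealCLM.hasDerivAt (x := (0 : ℝ))).mul_const X.trace
      simpa using h3.cexp
    simp only [h1] at h2
    exact h2.unique (hasDerivAt_const _ _)
  · rintro ⟨hXu, htr⟩ t
    refine ⟨⟨_, exp_mem_unitaryGroup ((u d).smul_mem t hXu)⟩, ?_, rfl⟩
    change (NormedSpace.exp (t • X)).det = 1
    rw [hdet X hXu, htr, mul_zero, Complex.exp_zero]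

theorem lieOf_inf (H K : Subgroup (U d)) : lieOf (H ⊓ K) = lieOf H ∩ lieOf K := by
  ext X
  constructor
  · intro hX
    exact ⟨fun t => (hX t).imp fun A hA => ⟨hA.1.1, hA.2⟩,
      fun t => (hX t).imp fun A hA => ⟨hA.1.2, hA.2⟩⟩
  · rintro ⟨h1, h2⟩ t
    obtain ⟨A, hA, hAX⟩ := h1 t
    obtain ⟨B, hB, hBX⟩ := h2 t
    exact ⟨A, ⟨hA, (Subtype.ext (hBX.trans hAX.symm) : B = A) ▸ hB⟩, hAX⟩

theorem range_blockLieHom (c : Composition d)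
    (g : ∀ j : Fin c.length,
      LieSubalgebra ℝ (Matrix (Fin (c.blocksFun j)) (Fin (c.blocksFun j)) ℂ)) :
    Set.range (blockLieHom c g) = {X | ∃ A, (∀ j, A j ∈ g j) ∧ X = blockDiag c A} := by
  ext X
  constructor
  · rintro ⟨Y, rfl⟩
    exact ⟨_, fun j => (Y j).2, rfl⟩
  · rintro ⟨A, hA, rfl⟩
    exact ⟨DFinsupp.equivFunOnFintype.symm fun j => ⟨A j, hA j⟩, rfl⟩

theorem blockLieHom_injective (c : Composition d)
    (g : ∀ j : Fin c.length,
      LieSubalgebra ℝ (Matrix (Fin (c.blocksFun j)) (Fin (c.blocksFun j)) ℂ)) :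
    Function.Injective (blockLieHom c g) := fun _ _ h =>
  DFinsupp.ext fun j => Subtype.ext (congrFun (blockDiag_injective c h) j)

theorem blockDiag_add (c : Composition d)
    (A B : ∀ j : Fin c.length, Matrix (Fin (c.blocksFun j)) (Fin (c.blocksFun j)) ℂ) :
    blockDiag c (fun j => A j + B j) = blockDiag c A + blockDiag c B := by
  ext a b
  exact congrFun (congrFun (blockDiagonal'_add A B) _) _

theorem blockDiag_smul (c : Composition d) (t : ℝ)
    (A : ∀ j : Fin c.length, Matrix (Fin (c.blocksFun j)) (Fin (c.blocksFun j)) ℂ) :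
    blockDiag c (fun j => t • A j) = t • blockDiag c A := by
  ext a b
  exact congrFun (congrFun (blockDiagonal'_smul t A) _) _

theorem blockDiag_neg (c : Composition d)
    (A : ∀ j : Fin c.length, Matrix (Fin (c.blocksFun j)) (Fin (c.blocksFun j)) ℂ) :
    blockDiag c (fun j => -A j) = -blockDiag c A := by
  ext a b
  exact congrFun (congrFun (blockDiagonal'_neg A) _) _

theorem trace_blockDiag (c : Composition d)
    (A : ∀ j : Fin c.length, Matrix (Fin (c.blocksFun j)) (Fin (c.blocksFun j)) ℂ) :
    (blockDiag c A).trace = ∑ j, (A j).trace := by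
  rw [← trace_blockDiagonal']
  exact c.blocksFinEquiv.symm.sum_comp fun x => blockDiagonal' A x x

theorem blockDiag_mem_u {c : Composition d}
    {A : ∀ j : Fin c.length, Matrix (Fin (c.blocksFun j)) (Fin (c.blocksFun j)) ℂ} :
    blockDiag c A ∈ u d ↔ ∀ j, A j ∈ u (c.blocksFun j) := by
  change (blockDiag c A)ᴴ = - blockDiag c A ↔ _
  rw [blockDiag_conjTranspose, ← blockDiag_neg, (blockDiag_injective c).eq_iff, funext_iff]
  rfl

theorem lieOf_blockU (c : Composition d) :
    lieOf (blockU c) = Set.range (blockLieHom c fun j => u (c.blocksFun j)) := by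
  rw [blockU_eq_relBlock, lieOf_relBlock, range_blockLieHom]
  ext X
  constructor
  · rintro ⟨hX, hb⟩
    obtain ⟨A, rfl⟩ := isBlock_blockSetoid_iff.1 hb
    exact ⟨A, blockDiag_mem_u.1 hX, rfl⟩
  · rintro ⟨A, hA, rfl⟩
    exact ⟨blockDiag_mem_u.2 hA, isBlock_blockDiag c A⟩

theorem mem_lieOf_blockSU {c : Composition d}
    {A : ∀ j : Fin c.length, Matrix (Fin (c.blocksFun j)) (Fin (c.blocksFun j)) ℂ} :
    blockDiag c A ∈ lieOf (blockSU c) ↔ (∀ j, A j ∈ u (c.blocksFun j)) ∧ ∑ j, (A j).trace = 0 := by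
  rw [blockSU, lieOf_inf, blockU_eq_relBlock, lieOf_relBlock, lieOf_SU, ← blockDiag_mem_u,
    ← trace_blockDiag]
  exact ⟨fun h => h.2, fun h => ⟨⟨h.1, isBlock_blockDiag c A⟩, h⟩⟩

/-- The block-scalar matrix with purely imaginary scalars. -/
def blockScalar (c : Composition d) : (Fin c.length → ℝ) →ₗ[ℝ] Matrix (Fin d) (Fin d) ℂ where
  toFun a := blockDiag c fun j => (Complex.I * (a j : ℂ)) • 1
  map_add' a b := by
    rw [← blockDiag_add]
    congr 1
    ext1 j
    simp [mul_add, add_smul]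
  map_smul' t a := by
    rw [RingHom.id_apply, ← blockDiag_smul]
    congr 1
    ext1 j
    rw [← Complex.coe_smul t, smul_smul, Pi.smul_apply, smul_eq_mul]
    push_cast
    congr 1
    ring

theorem blockScalar_apply (c : Composition d) (a : Fin c.length → ℝ) :
    blockScalar c a = blockDiag c fun j => (Complex.I * (a j : ℂ)) • 1 := rfl

theorem blockScalar_comm (c : Composition d) (a : Fin c.length → ℝ)
    (A : ∀ j : Fin c.length, Matrix (Fin (c.blocksFun j)) (Fin (c.blocksFun j)) ℂ) :
    blockScalar c a * blockDiag c A = blockDiag c A * blockScalar c a := by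
  simp [blockScalar_apply, ← blockDiag_mul]

/-- The weighted sum `∑ d_j a_j`, the trace of a block-scalar matrix up to a factor `i`. -/
def weightedSum (c : Composition d) : (Fin c.length → ℝ) →ₗ[ℝ] ℝ :=
  ∑ j, (c.blocksFun j : ℝ) • LinearMap.proj j

theorem weightedSum_apply (c : Composition d) (a : Fin c.length → ℝ) :
    weightedSum c a = ∑ j, (c.blocksFun j : ℝ) * a j := by
  simp [weightedSum]

theorem finrank_ker_weightedSum (c : Composition d) :
    Module.finrank ℝ (LinearMap.ker (weightedSum c)) = c.length - 1 := by
  have h := LinearMap.finrank_range_add_finrank_ker (weightedSum c)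
  rw [Module.finrank_fin_fun] at h
  -- With no blocks, the truncated r - 1 is 0, as it should be. Otherwise the functional is nonzero
  -- because block sizes are positive.
  rcases Nat.eq_zero_or_pos c.length with h0 | h0
  · omega
  · have hr : LinearMap.range (weightedSum c) = ⊤ := by
      refine LinearMap.range_eq_top.2 (LinearMap.surjective fun hw => ?_)
      have h1 : weightedSum c (Pi.single ⟨0, h0⟩ 1) = 0 := by rw [hw]; rfl
      have h2 := c.one_le_blocksFun ⟨0, h0⟩
      simp [weightedSum_apply, Pi.single_apply] at h1
      omega
    rw [hr, finrank_top, Module.finrank_self] at h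
    omega

/-- A parametrisation of the real solutions of `∑ d_j a_j = 0` by `r - 1` real numbers. -/
def kerEquiv (c : Composition d) :
    (Fin (c.length - 1) → ℝ) ≃ₗ[ℝ] LinearMap.ker (weightedSum c) :=
  LinearEquiv.ofFinrankEq _ _ (by rw [finrank_ker_weightedSum, Module.finrank_fin_fun])

/-- The embedding of `⨁ su(d_j) ⊕ iℝ^{r-1}` by block-diagonal and block-scalar matrices. -/
def blockSULieHom (c : Composition d) :
    ((⨁ j : Fin c.length, su (c.blocksFun j)) × (Fin (c.length - 1) → ℝ)) →ₗ⁅ℝ⁆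
      Matrix (Fin d) (Fin d) ℂ where
  toFun p := blockLieHom c (fun j => su (c.blocksFun j)) p.1 + blockScalar c (kerEquiv c p.2).1
  map_add' p q := by
    simp only [Prod.fst_add, Prod.snd_add, map_add, Submodule.coe_add]
    abel
  map_smul' t p := by
    simp only [Prod.smul_fst, Prod.smul_snd, map_smul, Submodule.coe_smul, RingHom.id_apply,
      smul_add]
  map_lie' := by
    intro p q
    have h0 : ⁅p.2, q.2⁆ = 0 := by
      ext j
      simp [Ring.lie_def, mul_comm]
    have h1 : ⁅p, q⁆ = (⁅p.1, q.1⁆, ⁅p.2, q.2⁆) := rfl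
    -- Block scalars commute with all block-diagonal matrices, so every cross term of the commutator
    -- cancels.
    have h2 := blockScalar_comm c (kerEquiv c p.2).1 (fun j => (q.1 j).1)
    have h3 := blockScalar_comm c (kerEquiv c q.2).1 (fun j => (p.1 j).1)
    have h4 := blockScalar_comm c (kerEquiv c p.2).1
      fun j => (Complex.I * (((kerEquiv c q.2).1 j : ℝ) : ℂ)) • 1
    rw [h1, h0, LieHom.map_lie, map_zero, ZeroMemClass.coe_zero, map_zero, add_zero]
    change blockScalar c (kerEquiv c p.2).1 * blockLieHom c (fun j => su (c.blocksFun j)) q.1 =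
      blockLieHom c (fun j => su (c.blocksFun j)) q.1 * blockScalar c (kerEquiv c p.2).1 at h2
    change blockScalar c (kerEquiv c q.2).1 * blockLieHom c (fun j => su (c.blocksFun j)) p.1 =
      blockLieHom c (fun j => su (c.blocksFun j)) p.1 * blockScalar c (kerEquiv c q.2).1 at h3
    rw [← blockScalar_apply] at h4
    simp only [Ring.lie_def, add_mul, mul_add, h2, h3, h4]
    abel

theorem blockSULieHom_apply (c : Composition d) (p) : blockSULieHom c p =
    blockDiag c fun j => (p.1 j).1 + (Complex.I * (((kerEquiv c p.2).1 j : ℝ) : ℂ)) • 1 := by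
  rw [blockDiag_add]
  rfl

theorem blockSULieHom_injective (c : Composition d) : Function.Injective (blockSULieHom c) := by
  rw [injective_iff_map_eq_zero]
  intro p hp
  have h0 : blockDiag c (fun _ => 0) = 0 := by
    simpa using blockDiag_smul c 0 (fun _ => 1)
  rw [blockSULieHom_apply, ← h0] at hp
  have hj := fun j => congrFun (blockDiag_injective c hp) j
  -- The trace of block j only sees the scalar, since the other summand is traceless, and d_j ≠ 0.
  have ha : ∀ j, (kerEquiv c p.2).1 j = 0 := by
    intro j
    have h1 := congrArg trace (hj j)
    rw [trace_add, (p.1 j).2.2, trace_smul, trace_one] at h1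
    have h2 := c.one_le_blocksFun j
    simpa [Nat.one_le_iff_ne_zero.1 h2] using h1
  refine Prod.ext (DFinsupp.ext fun j => Subtype.ext ?_) ?_
  · simpa [ha j] using hj j
  · exact (kerEquiv c).map_eq_zero_iff.1 (Subtype.ext (funext ha))

theorem smul_one_mem_u (n : ℕ) (a : ℝ) :
    (Complex.I * (a : ℂ)) • (1 : Matrix (Fin n) (Fin n) ℂ) ∈ u n := by
  change ((Complex.I * (a : ℂ)) • (1 : Matrix (Fin n) (Fin n) ℂ))ᴴ = _
  rw [conjTranspose_smul, conjTranspose_one, ← neg_smul]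
  simp

theorem lieOf_blockSU (c : Composition d) :
    lieOf (blockSU c) = Set.range (blockSULieHom c) := by
  ext X
  constructor
  · intro hX
    obtain ⟨A, rfl⟩ : ∃ A, X = blockDiag c A := by
      have hX' := hX
      rw [blockSU, lieOf_inf, blockU_eq_relBlock, lieOf_relBlock] at hX'
      exact isBlock_blockSetoid_iff.1 hX'.1.2
    obtain ⟨hA, htr⟩ := mem_lieOf_blockSU.1 hX
    have hne (j) : (c.blocksFun j : ℝ) ≠ 0 := by
      have := c.one_le_blocksFun j
      positivity
    -- Chosen so that i a_j I has the same trace as A j, which is purely imaginary. The weighted sum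
    -- of the a_j is then the imaginary part of the total trace, namely 0.
    let a : Fin c.length → ℝ := fun j => (A j).trace.im / c.blocksFun j
    have ha : weightedSum c a = 0 := by
      rw [weightedSum_apply, ← Complex.zero_im, ← htr, Complex.im_sum]
      exact Finset.sum_congr rfl fun j _ => mul_div_cancel₀ _ (hne j)
    have hB (j) : A j - (Complex.I * (a j : ℂ)) • 1 ∈ su (c.blocksFun j) := by
      refine ⟨(u _).sub_mem (hA j) (smul_one_mem_u _ _), ?_⟩
      have h1 := re_trace_eq_zero (hA j)
      rw [trace_sub, trace_smul, trace_one]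
      apply Complex.ext
      · simp [h1]
      · simp [a, hne]
    refine ⟨(DFinsupp.equivFunOnFintype.symm fun j => ⟨_, hB j⟩, (kerEquiv c).symm ⟨a, ha⟩), ?_⟩
    rw [blockSULieHom_apply]
    congr 1
    ext1 j
    rw [LinearEquiv.apply_symm_apply]
    exact sub_add_cancel _ _
  · rintro ⟨p, rfl⟩
    rw [blockSULieHom_apply, mem_lieOf_blockSU]
    refine ⟨fun j => (u _).add_mem (p.1 j).2.1 (smul_one_mem_u _ _), ?_⟩
    have h := (kerEquiv c p.2).2
    rw [LinearMap.mem_ker, weightedSum_apply] at h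
    have h' := congrArg (fun x : ℝ => Complex.I * (x : ℂ)) h
    simp only [Complex.ofReal_sum, Complex.ofReal_mul, Finset.mul_sum, Complex.ofReal_zero,
      mul_zero, Complex.ofReal_natCast] at h'
    rw [← h']
    refine Finset.sum_congr rfl fun j _ => ?_
    rw [trace_add, (p.1 j).2.2, trace_smul, trace_one, zero_add, smul_eq_mul, Fintype.card_fin]
    ring

/-! ### Adjoining scalars: reduction of the special unitary case. -/

/-- The scalar matrix with a unit complex number on the diagonal. -/
def scalarU (z : Circle) : U d :=
  ⟨(z : ℂ) • 1, by
    rw [mem_unitaryGroup_iff, star_eq_conjTranspose, conjTranspose_smul, conjTranspose_one,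
      smul_mul_smul_comm, one_mul]
    simp [Complex.mul_conj]⟩

theorem coe_scalarU (z : Circle) : ((scalarU z : U d) : Matrix (Fin d) (Fin d) ℂ) = (z : ℂ) • 1 :=
  rfl

theorem coe_scalarU_mul (z : Circle) (A : U d) :
    ((scalarU z * A : U d) : Matrix (Fin d) (Fin d) ℂ) =
      (z : ℂ) • (A : Matrix (Fin d) (Fin d) ℂ) := by
  rw [Submonoid.coe_mul, coe_scalarU, smul_mul_assoc, one_mul]

theorem scalarU_mul_mul (z w : Circle) (A B : U d) :
    scalarU z * A * (scalarU w * B) = scalarU (z * w) * (A * B) := by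
  apply Subtype.ext
  rw [Submonoid.coe_mul, coe_scalarU_mul, coe_scalarU_mul, coe_scalarU_mul, Submonoid.coe_mul,
    smul_mul_smul_comm, Circle.coe_mul]

theorem scalarU_one : (scalarU 1 : U d) = 1 := Subtype.ext (by simp [coe_scalarU])

theorem continuous_scalarU : Continuous (scalarU : Circle → U d) :=
  Continuous.subtype_mk (by fun_prop) _

theorem diagPhase_const (s : ℝ) : (diagPhase fun _ => s : U d) = scalarU (Circle.exp s) := by
  apply Subtype.ext
  rw [coe_scalarU, Circle.coe_exp, smul_one_eq_diagonal]
  rfl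

theorem diagPhase_add (θ η : Fin d → ℝ) : diagPhase (θ + η) = diagPhase θ * diagPhase η := by
  apply Subtype.ext
  change diagonal _ = diagonal _ * diagonal _
  rw [diagonal_mul_diagonal]
  congr 1
  ext j
  rw [← Complex.exp_add]
  simp [add_mul]

/-- The subgroup generated by `H` and the scalar unitary matrices. -/
def scalarExtension (H : Subgroup (U d)) : Subgroup (U d) where
  carrier := (fun p : Circle × U d => scalarU p.1 * p.2) '' (Set.univ ×ˢ (H : Set (U d)))
  one_mem' := ⟨(1, 1), ⟨trivial, H.one_mem⟩, by simp [scalarU_one]⟩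
  mul_mem' := by
    rintro _ _ ⟨p, hp, rfl⟩ ⟨q, hq, rfl⟩
    exact ⟨(p.1 * q.1, p.2 * q.2), ⟨trivial, H.mul_mem hp.2 hq.2⟩,
      (scalarU_mul_mul _ _ _ _).symm⟩
  inv_mem' := by
    rintro _ ⟨p, hp, rfl⟩
    refine ⟨(p.1⁻¹, p.2⁻¹), ⟨trivial, H.inv_mem hp.2⟩, eq_inv_of_mul_eq_one_left ?_⟩
    rw [scalarU_mul_mul, inv_mul_cancel, inv_mul_cancel, scalarU_one, one_mul]

theorem mem_scalarExtension {H : Subgroup (U d)} {A : U d} :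
    A ∈ scalarExtension H ↔ ∃ z : Circle, ∃ B ∈ H, scalarU z * B = A := by
  constructor
  · rintro ⟨p, hp, rfl⟩
    exact ⟨p.1, p.2, hp.2, rfl⟩
  · rintro ⟨z, B, hB, rfl⟩
    exact ⟨(z, B), ⟨trivial, hB⟩, rfl⟩

theorem continuous_scalarU_mul : Continuous fun p : Circle × U d => scalarU p.1 * p.2 :=
  (continuous_scalarU.comp continuous_fst).mul continuous_snd

theorem isClosed_scalarExtension {H : Subgroup (U d)} (hH : IsClosed (H : Set (U d))) :
    IsClosed (scalarExtension H : Set (U d)) :=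
  ((isCompact_univ.prod hH.isCompact).image continuous_scalarU_mul).isClosed

theorem isConnected_scalarExtension {H : Subgroup (U d)} (hH : IsConnected (H : Set (U d))) :
    IsConnected (scalarExtension H : Set (U d)) := by
  have hc : IsConnected (Set.univ : Set Circle) := by
    have hs : Function.Surjective Circle.exp := fun z => ⟨(z : ℂ).arg, Circle.exp_arg z⟩
    rw [← hs.range_eq]
    exact isConnected_range Circle.exp.continuous
  exact (hc.prod hH).image _ continuous_scalarU_mul.continuousOn

theorem torusU_subset_scalarExtension {H : Subgroup (U d)}
    (hT : torusSU d ⊆ (H : Set (U d))) : torusU d ⊆ (scalarExtension H : Set (U d)) := by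
  rintro _ ⟨θ, rfl⟩
  -- Factoring out the mean phase leaves phases of sum 0; for d = 0 the sum is empty.
  let s : ℝ := (∑ j, θ j) / d
  have hs : ∑ j, (θ j - s) = 0 := by
    rcases Nat.eq_zero_or_pos d with rfl | hd
    · simp
    · have : (d : ℝ) ≠ 0 := by positivity
      simp [s, mul_div_cancel₀ _ this]
  refine mem_scalarExtension.2 ⟨Circle.exp s, diagPhase fun j => θ j - s,
    hT ⟨_, ⟨0, by simpa using hs⟩, rfl⟩, ?_⟩
  rw [← diagPhase_const, ← diagPhase_add]
  congr 1
  ext j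
  simp

theorem scalarU_mem_torusSU {z : Circle} (hz : (z : ℂ) ^ d = 1) :
    (scalarU z : U d) ∈ torusSU d := by
  refine ⟨fun _ => (z : ℂ).arg, ?_, ?_⟩
  · have h1 : Complex.exp (d * ((z : ℂ).arg * Complex.I)) = 1 := by
      rw [Complex.exp_nat_mul, ← Circle.coe_exp, Circle.exp_arg, hz]
    obtain ⟨k, hk⟩ := Complex.exp_eq_one_iff.1 h1
    refine ⟨k, ?_⟩
    have h2 : ((d * (z : ℂ).arg : ℝ) : ℂ) * Complex.I =
        ((k * (2 * Real.pi) : ℝ) : ℂ) * Complex.I := by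
      push_cast
      linear_combination hk
    simpa using Complex.ofReal_injective (mul_right_cancel₀ Complex.I_ne_zero h2)
  · rw [diagPhase_const, Circle.exp_arg]

/-- A subgroup of `SU(d)` containing the torus is recovered from its scalar extension. -/
theorem scalarExtension_inf_SU {H : Subgroup (U d)} (hSU : H ≤ SU d)
    (hT : torusSU d ⊆ (H : Set (U d))) : scalarExtension H ⊓ SU d = H := by
  apply le_antisymm
  · rintro _ ⟨hA, hdet⟩
    obtain ⟨z, B, hB, rfl⟩ := mem_scalarExtension.1 hA
    have h1 : (B : Matrix (Fin d) (Fin d) ℂ).det = 1 := hSU hB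
    have h2 : ((scalarU z * B : U d) : Matrix (Fin d) (Fin d) ℂ).det = 1 := hdet
    -- Both determinants are 1, so z^d = 1 and the scalar matrix already lies in the torus of
    -- `SU(d)`.
    rw [coe_scalarU_mul, det_smul, h1, mul_one, Fintype.card_fin] at h2
    exact H.mul_mem (hT (scalarU_mem_torusSU h2)) hB
  · exact fun A hA => ⟨mem_scalarExtension.2 ⟨1, A, hA, by rw [scalarU_one, one_mul]⟩, hSU hA⟩

end BlockUnitary

end

open BlockUnitary
theorem mainTheorem2 (d : ℕ) (H : Subgroup (U d))
    (hclosed : IsClosed (H : Set (U d))) (hconn : IsConnected (H : Set (U d))) :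
    -- the case `G = U(d)`
    (torusU d ⊆ (H : Set (U d)) →
      (∃ (c : Composition d) (σ : Equiv.Perm (Fin d)),
        conjSubgroup (permU σ) H = blockU c ∧
        lieOf (conjSubgroup (permU σ) H) = conjSet (permU σ) (lieOf H) ∧
        Function.Injective (blockLieHom c fun j => u (c.blocksFun j)) ∧
        lieOf (conjSubgroup (permU σ) H) =
          Set.range (blockLieHom c fun j => u (c.blocksFun j))) ∧
      (H ≠ ⊤ → PreservesCoordSubspace H)) ∧
    -- the case `G = SU(d)`
    (H ≤ SU d → torusSU d ⊆ (H : Set (U d)) →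
      (∃ (c : Composition d) (σ : Equiv.Perm (Fin d)),
        conjSubgroup (permU σ) H = blockSU c ∧
        lieOf (conjSubgroup (permU σ) H) = conjSet (permU σ) (lieOf H) ∧
        -- `Lie (P H P⁻¹) = ⨁ su(d_j) ⊕ iℝ^{r-1}`: the first summand embedded by blocks,
        -- the second one (abelian) as block-scalar matrices
        ∃ Φ : ((⨁ j : Fin c.length, su (c.blocksFun j)) × (Fin (c.length - 1) → ℝ)) →ₗ⁅ℝ⁆
            Matrix (Fin d) (Fin d) ℂ,
          Function.Injective Φ ∧
          (∀ X, Φ (X, 0) = blockLieHom c (fun j => su (c.blocksFun j)) X) ∧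
          (∀ v, Φ (0, v) ∈ blockScalars c) ∧
          lieOf (conjSubgroup (permU σ) H) = Set.range Φ) ∧
      (H ≠ SU d → PreservesCoordSubspace H)) := by
  constructor
  · intro hT
    obtain ⟨r, rfl⟩ := exists_eq_relBlock hclosed hconn hT
    obtain ⟨c, σ, hσ⟩ := exists_perm r
    have hconj : conjSubgroup (permU σ) (relBlock r) = blockU c :=
      (conjSubgroup_relBlock hσ).trans (blockU_eq_relBlock c).symm
    refine ⟨⟨c, σ, hconj, lieOf_conjSubgroup _ _, blockLieHom_injective c _, ?_⟩, fun hne => ?_⟩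
    · rw [hconj, lieOf_blockU]
    · by_contra hcon
      refine hne (relBlock_eq_top fun i j => ?_)
      by_contra hij
      exact hcon (preservesCoordSubspace_of_le_relBlock le_rfl hij)
  · intro hSU hT
    obtain ⟨r, hr⟩ := exists_eq_relBlock (isClosed_scalarExtension hclosed)
      (isConnected_scalarExtension hconn) (torusU_subset_scalarExtension hT)
    -- From here on only the block pattern r of the scalar extension matters.
    obtain rfl : relBlock r ⊓ SU d = H := by rw [← hr, scalarExtension_inf_SU hSU hT]
    obtain ⟨c, σ, hσ⟩ := exists_perm r
    have hconj : conjSubgroup (permU σ) (relBlock r ⊓ SU d) = blockSU c := by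
      rw [conjSubgroup_inf_SU, conjSubgroup_relBlock hσ, blockSU, blockU_eq_relBlock]
    refine ⟨⟨c, σ, hconj, lieOf_conjSubgroup _ _, blockSULieHom c, blockSULieHom_injective c,
      fun X => ?_, fun v => ⟨(kerEquiv c v).1, ?_⟩, ?_⟩, fun hne => ?_⟩
    · change blockLieHom c _ X + blockScalar c (kerEquiv c 0).1 = _
      rw [map_zero, ZeroMemClass.coe_zero, map_zero, add_zero]
    · change _ = blockLieHom c _ 0 + blockScalar c (kerEquiv c v).1
      rw [map_zero, zero_add, blockScalar_apply]
    · rw [hconj, lieOf_blockSU]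
    · by_contra hcon
      refine hne ?_
      rw [relBlock_eq_top fun i j => ?_, top_inf_eq]
      by_contra hij
      exact hcon (preservesCoordSubspace_of_le_relBlock inf_le_left hij)
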